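/- Let $k$ be a field with a separable closure $k^s$ and absolute Galois group $\Gamma = \mathrm{Gal}(k^s/k)$. Let $A$ be a finite discrete $\Gamma$-module (a finite abelian group with a continuous action of $\Gamma$) whose order is invertible in $k$; equivalently, a finite étale $k$-group scheme of multiplicative type. Let $n \geq 3$ be an integer and let $\alpha \in H^n(k,A) = H^n(\Gamma, A)$ be a Galois cohomology class. By a $k$-variety we mean a separated $k$-scheme of finite type. Then there exist smooth, geometrically integral $k$-varieties $X_i$ ($i \in \mathbb{N}$) and closed embeddings of $k$-varieties $X_i \to X_{i+1}$ for all $i \geq 0$, such that $(X_i)_{i\in\mathbb{N}}$ is a splitting family for $\alpha$: for every field extension $l/k$ with $l$ infinite, the restriction of $\alpha$ to $H^n(l,A)$ vanishes if and only if $X_i(l) \neq \emptyset$ for some $i \in \mathbb{N}$. (Here $H^n(l,A) = H^n(\mathrm{Gal}(l^s/l),A)$, where $l^s$ is a separable closure of $l$ and $\mathrm{Gal}(l^s/l)$ acts on $A$ through the restriction homomorphism $\mathrm{Gal}(l^s/l) \to \Gamma$ given by a $k$-embedding $k^s \to l^s$; the vanishing of the restriction does not depend on the choices of $l^s$ and of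 the embedding.) -/

import Mathlib

open CategoryTheory AlgebraicGeometry

universe u

noncomputable section

namespace GaloisSplitting

/-! ### Restriction of Galois groups along a field extension -/

section Restriction

variable (k ks l ls : Type u) [Field k] [Field ks] [Algebra k ks] [IsSepClosure k ks]
  [Field l] [Algebra k l] [Field ls] [Algebra l ls]
  [Algebra k ls] [IsScalarTower k l ls] [Algebra ks ls] [IsScalarTower k ks ls]

/-- Let `l / k` be a field extension, `ks / k` a separable closure and `ks → ls` an embedding over
`k` into an extension `ls` of `l` (in practice a separable closure of `l`). This is the restriction
homomorphism `Gal(ls / l) → Gal(ks / k)`, `σ ↦ σ|_ks`. -/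
def restrictHom : Gal(ls/l) →* Gal(ks/k) :=
  (AlgEquiv.restrictNormalHom ks).comp
    { toFun := fun σ => σ.restrictScalars k
      map_one' := rfl
      map_mul' := fun _ _ => rfl }

theorem algebraMap_restrictHom (σ : Gal(ls/l)) (x : ks) :
    algebraMap ks ls (restrictHom k ks l ls σ x) = σ (algebraMap ks ls x) :=
  AlgEquiv.restrictNormal_commutes (σ.restrictScalars k) ks x

theorem continuous_restrictHom : Continuous (restrictHom k ks l ls) := by
  refine continuous_of_continuousAt_one _ ?_
  rw [ContinuousAt, map_one]
  intro U hU
  obtain ⟨E, hE, hEU⟩ := (krullTopology_mem_nhds_one_iff k ks U).1 hU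
  obtain ⟨s, hs⟩ := IntermediateField.essFiniteType_iff.1 (inferInstance : Algebra.EssFiniteType k E)
  let F : IntermediateField l ls := IntermediateField.adjoin l (algebraMap ks ls '' (s : Set ks))
  have : Finite (algebraMap ks ls '' (s : Set ks)) := (s.finite_toSet.image _).to_subtype
  have : FiniteDimensional l F := by
    refine IntermediateField.finiteDimensional_adjoin ?_
    rintro _ ⟨x, -, rfl⟩
    have hx : IsIntegral k x := Algebra.IsIntegral.isIntegral x
    exact (hx.map (IsScalarTower.toAlgHom k ks ls)).tower_top
  refine Filter.mem_map.2 (Filter.mem_of_superset (F.fixingSubgroup_isOpen.mem_nhds (one_mem _)) ?_)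
  intro σ hσ
  refine hEU ?_
  have hle : E ≤ IntermediateField.fixedField (Subgroup.zpowers (restrictHom k ks l ls σ)) := by
    rw [← hs, IntermediateField.adjoin_le_iff]
    intro x hx
    rw [SetLike.mem_coe, IntermediateField.mem_fixedField_iff]
    intro τ hτ
    refine (Subgroup.zpowers_le (H := MulAction.stabilizer Gal(ks/k) x)).2 ?_ hτ
    rw [MulAction.mem_stabilizer_iff, AlgEquiv.smul_def]
    apply (algebraMap ks ls).injective
    rw [algebraMap_restrictHom]
    exact (IntermediateField.mem_fixingSubgroup_iff F σ).1 hσ _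
      (IntermediateField.subset_adjoin l _ ⟨x, hx, rfl⟩)
  exact (IntermediateField.le_iff_le _ _).1 hle (Subgroup.mem_zpowers _)

/-- The restriction homomorphism `Gal(ls / l) → Gal(ks / k)`, as a continuous homomorphism for the
Krull topologies. -/
def restrict : Gal(ls/l) →ₜ* Gal(ks/k) where
  toMonoidHom := restrictHom k ks l ls
  continuous_toFun := continuous_restrictHom k ks l ls

end Restriction

/-! ### Galois cohomology of discrete modules -/

section Cohomology

/-- A discrete abelian group `A` with an action of `G`, as a representation over `ℤ`. -/
def discreteModule (G A : Type u) [Group G] [AddCommGroup A] [TopologicalSpace A]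
    [DiscreteTopology A] [DistribMulAction G A] : TopRep.{u} ℤ G :=
  TopRep.of (X := A) (ContRepresentation.ofMonoidHom
    { toFun := fun g =>
        { toLinearMap := (DistribSMul.toAddMonoidHom A g).toIntLinearMap
          cont := continuous_of_discreteTopology }
      map_one' := by ext a; exact one_smul G a
      map_mul' := fun g h => by ext a; exact mul_smul g h a })

/-- The Galois cohomology group `Hⁿ(k, A) = Hⁿ(Gal(ks / k), A)`, as cohomology of continuous
cochains. -/
abbrev galoisCohomology (k ks : Type u) [Field k] [Field ks] [Algebra k ks] (n : ℕ)
    (A : TopRep.{u} ℤ Gal(ks/k)) : TopModuleCat ℤ :=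
  continuousCohomology n A

/-- The restriction map `Hⁿ(k, A) → Hⁿ(l, A)` attached to a field extension `l / k` and an
embedding `ks → ls` of separable closures; `Gal(ls / l)` acts on `A` through `Gal(ks / k)`. -/
def res (k ks l ls : Type u) [Field k] [Field ks] [Algebra k ks] [IsSepClosure k ks]
    [Field l] [Algebra k l] [Field ls] [Algebra l ls]
    [Algebra k ls] [IsScalarTower k l ls] [Algebra ks ls] [IsScalarTower k ks ls]
    (n : ℕ) (A : TopRep.{u} ℤ Gal(ks/k)) :
    galoisCohomology k ks n A ⟶
      galoisCohomology l ls n (TopRep.res (restrict k ks l ls : Gal(ls/l) →* Gal(ks/k)) A) :=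
  ContinuousCohomology.map (restrict k ks l ls) (𝟙 _) n

end Cohomology

/-! ### Varieties, ind-varieties and splitting families -/

section Varieties

variable {k : Type u} [Field k]

/-- A smooth, geometrically integral `k`-variety: a separated `k`-scheme of finite type which is
smooth and geometrically integral over `k`. -/
structure IsSmoothGeomIntegralVariety (X : Over (Spec (CommRingCat.of k))) : Prop where
  separated : IsSeparated X.hom
  locallyOfFiniteType : LocallyOfFiniteType X.hom
  quasiCompact : QuasiCompact X.hom
  smooth : Smooth X.hom
  geometricallyIntegral : GeometricallyIntegral X.hom

/-- The `k`-scheme `X` has an `l`-point, i.e. there is a `k`-morphism `Spec l → X`. -/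
def HasPoint (X : Over (Spec (CommRingCat.of k))) (l : Type u) [Field l] [Algebra k l] : Prop :=
  Nonempty (Over.mk (Spec.map (CommRingCat.ofHom (algebraMap k l))) ⟶ X)

/-- The family `X` of `k`-schemes splits `α ∈ Hⁿ(k, A)`: for every field extension `l / k` with `l`
infinite (and every choice of a separable closure `ls` of `l` and of a `k`-embedding `ks → ls`), the
restriction of `α` to `l` vanishes if and only if some `X i` has an `l`-point. -/
def IsSplittingFamily {ks : Type u} [Field ks] [Algebra k ks] [IsSepClosure k ks] {n : ℕ}
    {A : TopRep.{u} ℤ Gal(ks/k)} (α : galoisCohomology k ks n A)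
    {I : Type} (X : I → Over (Spec (CommRingCat.of k))) : Prop :=
  ∀ (l ls : Type u) [Field l] [Infinite l] [Algebra k l] [Field ls] [Algebra l ls]
    [IsSepClosure l ls] [Algebra k ls] [IsScalarTower k l ls] [Algebra ks ls]
    [IsScalarTower k ks ls],
    res k ks l ls n A α = 0 ↔ ∃ i, HasPoint (X i) l

variable (k) in
/-- A smooth, geometrically integral ind-variety over `k`: a sequence `(X i)` of smooth,
geometrically integral `k`-varieties with closed embeddings `X i → X (i + 1)` over `k`. -/
structure SmoothGeomIntegralIndVariety where
  X : ℕ → Over (Spec (CommRingCat.of k))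
  isVariety (i : ℕ) : IsSmoothGeomIntegralVariety (X i)
  ι (i : ℕ) : X i ⟶ X (i + 1)
  isClosedImmersion (i : ℕ) : IsClosedImmersion (ι i).left

end Varieties

end GaloisSplitting

end

/-!
Let `α` be a class of degree `n ≥ 2`. The cocycle of `α` and the action on the coefficients come from
a finite Galois extension `K / k` with group `G`, so that `α` is inflated from a class `c` of `G`.
The restriction of `α` to `l` is the pullback of `c` along `Gal(ls / l) → G`, and it vanishes exactly
when this homomorphism factors, continuously, through a finite group `H → G` on which `c` dies.

*Groups.* If the cocycle of `c` is the differential of a (not invariant) cochain `x`, then the pairs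
`(g, y)` with `g` in the group and `d y = g x - x` form a finite group, the `CochainExtension`. The
class dies on it, and every embedding of a group on which `c` dies lifts to it
(`exists_lift_cochainExtension`). After inflating `c` to `G × Perm Y`, this yields finite groups
`E₀ ⊆ E₁ ⊆ ⋯` over `G` on which `c` dies and such that every finite group over `G` on which `c` dies
maps to some `Eᵢ` over `G` (`exists_splittingGroup_tower`). So `α` vanishes over `l` if and only if
`Gal(ls / l) → G` lifts to some `Eᵢ`.

*Varieties.* For a surjection `p : E → G` let `E` act on `GL_E` over `K`, through `p` on `K` and by
permutation of the rows. The action is free, so the coordinate ring is a Galois extension of the ring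
of invariants `R`, which is smooth over `k` because smoothness descends along a faithfully flat étale
extension (`smooth_of_etale_of_faithfullyFlat`). Since `p` is surjective, `K ⊗ R` embeds in the
coordinate ring of `GL_E` over `K` by Galois descent, so that `R` stays a domain over every extension
of `k` (`QuotientRing.isDomain_tensorProduct`). A point of `R` over `l` lifts to a point `s` of `GL_E`
over `ls`, and comparing `γ ∘ s` with `s` yields a lift of `Gal(ls / l) → G` to `E`; conversely, a lift
yields a point by the vanishing of `H¹` with values in `GL_E` (`QuotientRing.nonempty_algHom_iff`).

*The ind-variety.* The inclusion of `Eᵢ` in `Eᵢ₊₁` and block diagonal matrices yield homomorphisms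
`Rᵢ₊₁ → Rᵢ`. Multiplying the varieties by affine spaces of increasing dimension does not change which
fields have points on them, and it turns these morphisms into closed embeddings
(`exists_surjective_tower`).
-/

namespace GaloisSplitting

/-! ### Nested cochains -/

/-- Functions of `n` variables in `X` with values in `A`, in curried form `X → X → ⋯ → A`. This is
the shape of the cochains that define continuous cohomology, without the continuity. Homogeneous
cochains of degree `n` are functions of `n + 1` variables. -/
def NestedFun (X A : Type u) : ℕ → Type u
  | 0 => A
  | n + 1 => X → NestedFun X A n

namespace NestedFun

variable {X Y Z A B C : Type u} [AddCommGroup A] [AddCommGroup B] [AddCommGroup C]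

instance instAddCommGroup (X A : Type u) [AddCommGroup A] : ∀ n, AddCommGroup (NestedFun X A n)
  | 0 => inferInstanceAs (AddCommGroup A)
  | n + 1 => @Pi.addCommGroup X (fun _ => NestedFun X A n) fun _ => instAddCommGroup X A n

instance instFinite (X A : Type u) [Finite X] [Finite A] : ∀ n, Finite (NestedFun X A n)
  | 0 => inferInstanceAs (Finite A)
  | n + 1 => @Pi.finite X (fun _ => NestedFun X A n) _ fun _ => instFinite X A n

@[simp] theorem add_apply {n : ℕ} (f g : NestedFun X A (n + 1)) (x : X) :
    (f + g) x = f x + g x := rfl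

@[simp] theorem sub_apply {n : ℕ} (f g : NestedFun X A (n + 1)) (x : X) :
    (f - g) x = f x - g x := rfl

@[simp] theorem zero_apply {n : ℕ} (x : X) : (0 : NestedFun X A (n + 1)) x = 0 := rfl

/-- The homogeneous differential: the alternating sum of the functions obtained by omitting one
variable. -/
def diff (X A : Type u) [AddCommGroup A] : ∀ n, NestedFun X A n →+ NestedFun X A (n + 1)
  | 0 => { toFun := fun a _ => a, map_zero' := rfl, map_add' := fun _ _ => rfl }
  | n + 1 =>
    { toFun := fun f x => f - diff X A n (f x)
      map_zero' := by
        funext x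
        simp only [zero_apply, map_zero, sub_zero]
      map_add' := fun f g => by
        funext x
        change f + g - diff X A n (f x + g x) = (f - diff X A n (f x)) + (g - diff X A n (g x))
        rw [map_add]
        abel }

variable {n : ℕ}

theorem diff_succ_apply (f : NestedFun X A (n + 1)) (x : X) :
    diff X A (n + 1) f x = f - diff X A n (f x) := rfl

theorem diff_diff : ∀ {n : ℕ} (f : NestedFun X A n), diff X A (n + 1) (diff X A n f) = 0
  | 0, f => by
    funext x
    rw [diff_succ_apply]
    exact sub_self _
  | n + 1, f => by
    funext x
    rw [diff_succ_apply, diff_succ_apply, map_sub, diff_diff (f x)]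
    simp

/-- Evaluating the first variable is a contracting homotopy. -/
theorem diff_eval (x : X) (f : NestedFun X A (n + 1)) (hf : diff X A (n + 1) f = 0) :
    diff X A n (f x) = f := by
  have h := congrFun hf x
  rw [diff_succ_apply] at h
  exact (sub_eq_zero.1 h).symm

/-- Substitution of variables and change of coefficients. -/
def transport (a : A →+ B) (s : Y → X) : ∀ n, NestedFun X A n →+ NestedFun Y B n
  | 0 => a
  | n + 1 =>
    { toFun := fun f y => transport a s n (f (s y))
      map_zero' := by funext y; exact map_zero (transport a s n)
      map_add' := fun f g => by funext y; exact map_add (transport a s n) _ _ }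

theorem transport_succ_apply (a : A →+ B) (s : Y → X) (f : NestedFun X A (n + 1)) (y : Y) :
    transport a s (n + 1) f y = transport a s n (f (s y)) := rfl

theorem transport_transport (a : A →+ B) (s : Y → X) (b : B →+ C) (t : Z → Y) :
    ∀ {n : ℕ} (f : NestedFun X A n),
      transport b t n (transport a s n f) = transport (b.comp a) (s ∘ t) n f
  | 0, _ => rfl
  | n + 1, f => by
    funext z
    exact transport_transport a s b t (f (s (t z)))

theorem transport_id (f : NestedFun X A n) : transport (AddMonoidHom.id A) id n f = f := by
  induction n with
  | zero => rfl
  | succ n ih => funext x; exact ih (f x)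

theorem transport_diff (a : A →+ B) (s : Y → X) :
    ∀ {n : ℕ} (f : NestedFun X A n),
      transport a s (n + 1) (diff X A n f) = diff Y B n (transport a s n f)
  | 0, _ => rfl
  | n + 1, f => by
    funext y
    rw [transport_succ_apply, diff_succ_apply, diff_succ_apply, map_sub, transport_diff a s]
    rfl

/-- Restriction of variables along a map. -/
def pull (A : Type u) [AddCommGroup A] (s : Y → X) (n : ℕ) : NestedFun X A n →+ NestedFun Y A n :=
  transport (AddMonoidHom.id A) s n

theorem pull_succ_apply (s : Y → X) (f : NestedFun X A (n + 1)) (y : Y) :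
    pull A s (n + 1) f y = pull A s n (f (s y)) := rfl

theorem pull_diff (s : Y → X) (f : NestedFun X A n) :
    pull A s (n + 1) (diff X A n f) = diff Y A n (pull A s n f) :=
  transport_diff _ s f

theorem pull_pull (s : Y → X) (t : Z → Y) (f : NestedFun X A n) :
    pull A t n (pull A s n f) = pull A (s ∘ t) n f :=
  transport_transport _ s _ t f

theorem pull_injective {s : Y → X} (hs : Function.Surjective s) :
    Function.Injective (pull A s n) := by
  induction n with
  | zero => exact fun _ _ h => h
  | succ n ih =>
    intro f g h
    funext x
    obtain ⟨y, rfl⟩ := hs x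
    exact ih (congrFun h y)

/-- The prism operator, a homotopy between restriction along `s` and restriction along `t`. -/
def prism (A : Type u) [AddCommGroup A] (s t : Y → X) :
    ∀ n, NestedFun X A (n + 1) →+ NestedFun Y A n
  | 0 => 0
  | n + 1 =>
    { toFun := fun f y => pull A t n (f (s y) (t y)) - prism A s t n (f (s y))
      map_zero' := by
        funext y
        simp only [zero_apply, map_zero, sub_zero]
      map_add' := fun f g => by
        funext y
        change pull A t n (f (s y) (t y) + g (s y) (t y)) - prism A s t n (f (s y) + g (s y)) =
          (pull A t n (f (s y) (t y)) - prism A s t n (f (s y))) +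
            (pull A t n (g (s y) (t y)) - prism A s t n (g (s y)))
        rw [map_add, map_add]
        abel }

theorem prism_succ_apply (s t : Y → X) (f : NestedFun X A (n + 2)) (y : Y) :
    prism A s t (n + 1) f y = pull A t n (f (s y) (t y)) - prism A s t n (f (s y)) := rfl

theorem diff_prism_add_prism_diff (s t : Y → X) : ∀ {n : ℕ} (f : NestedFun X A (n + 1)),
    diff Y A n (prism A s t n f) + prism A s t (n + 1) (diff X A (n + 1) f) =
      pull A t (n + 1) f - pull A s (n + 1) f
  | 0, f => by
    funext y
    exact (zero_add _).trans (sub_zero _)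
  | n + 1, f => by
    funext y
    have ih := diff_prism_add_prism_diff s t (f (s y))
    have h1 : diff Y A (n + 1) (prism A s t (n + 1) f) y = prism A s t (n + 1) f -
        (pull A t (n + 1) (diff X A n (f (s y) (t y))) - diff Y A n (prism A s t n (f (s y)))) := by
      rw [diff_succ_apply, prism_succ_apply, map_sub, pull_diff]
    have h2 : prism A s t (n + 2) (diff X A (n + 2) f) y =
        (pull A t (n + 1) (f (t y)) -
          (pull A t (n + 1) (f (s y)) - pull A t (n + 1) (diff X A n (f (s y) (t y))))) -
        (prism A s t (n + 1) f - prism A s t (n + 1) (diff X A (n + 1) (f (s y)))) := by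
      rw [prism_succ_apply, diff_succ_apply, map_sub, sub_apply, map_sub, diff_succ_apply, map_sub]
    rw [← eq_sub_iff_add_eq'] at ih
    rw [add_apply, sub_apply, h1, h2, ih, pull_succ_apply, pull_succ_apply]
    abel

theorem transport_prism (a : A →+ B) (s t : Y → X) (σ : X → X) (τ : Y → Y)
    (hs : s ∘ τ = σ ∘ s) (ht : t ∘ τ = σ ∘ t) : ∀ {n : ℕ} (f : NestedFun X A (n + 1)),
    transport a τ n (prism A s t n f) = prism B s t n (transport a σ (n + 1) f)
  | 0, f => map_zero a
  | n + 1, f => by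
    funext y
    have hs' : s (τ y) = σ (s y) := congrFun hs y
    have ht' : t (τ y) = σ (t y) := congrFun ht y
    rw [transport_succ_apply, prism_succ_apply, prism_succ_apply, map_sub,
      transport_prism a s t σ τ hs ht, hs', ht', transport_succ_apply, transport_succ_apply]
    congr 1
    simp only [pull, transport_transport, ht]
    rfl

section Action

variable {G H K : Type u} [Group G] [Group H] [Group K]

/-- The endomorphism of the coefficients by which a group element acts. -/
def coeff (χ : G →* AddMonoid.End A) (g : G) : A →+ A := χ g

theorem coeff_mul (χ : G →* AddMonoid.End A) (g h : G) :
    coeff χ (g * h) = (coeff χ g).comp (coeff χ h) := map_mul χ g h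

theorem coeff_one (χ : G →* AddMonoid.End A) : coeff χ 1 = AddMonoidHom.id A := map_one χ

/-- The action of a group on functions of variables in the group, with coefficients in a module. -/
def act (χ : G →* AddMonoid.End A) (g : G) (n : ℕ) : NestedFun G A n →+ NestedFun G A n :=
  transport (coeff χ g) (g⁻¹ * ·) n

theorem act_mul (χ : G →* AddMonoid.End A) (g h : G) (f : NestedFun G A n) :
    act χ (g * h) n f = act χ g n (act χ h n f) := by
  rw [act, act, act, transport_transport, coeff_mul]
  congr 2
  funext x
  simp [mul_assoc]

theorem act_one (χ : G →* AddMonoid.End A) (f : NestedFun G A n) : act χ 1 n f = f := by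
  have h : ((1 : G)⁻¹ * · : G → G) = id := by
    funext x
    simp
  rw [act, coeff_one, h]
  exact transport_id f

theorem act_diff (χ : G →* AddMonoid.End A) (g : G) (f : NestedFun G A n) :
    act χ g (n + 1) (diff G A n f) = diff G A n (act χ g n f) :=
  transport_diff _ _ f

theorem act_pull (χ : G →* AddMonoid.End A) (p : H →* G) (h : H) (f : NestedFun G A n) :
    act (χ.comp p) h n (pull A p n f) = pull A p n (act χ (p h) n f) := by
  unfold act pull
  rw [transport_transport, transport_transport]
  congr 2
  funext x
  simp

/-- The restriction of the class of the cocycle `c` along `p` vanishes: it is the differential of an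
invariant cochain. -/
def DiesOn (χ : G →* AddMonoid.End A) (c : NestedFun G A (n + 1)) (p : H →* G) : Prop :=
  ∃ φ : NestedFun H A n, (∀ h, act (χ.comp p) h n φ = φ) ∧ diff H A n φ = pull A p (n + 1) c

theorem DiesOn.comp {χ : G →* AddMonoid.End A} {c : NestedFun G A (n + 1)} {p : H →* G}
    (h : DiesOn χ c p) (q : K →* H) : DiesOn χ c (p.comp q) := by
  obtain ⟨φ, hφ, hc⟩ := h
  refine ⟨pull A q n φ, fun k => ?_, ?_⟩
  · rw [← MonoidHom.comp_assoc, act_pull, hφ]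
  · rw [← pull_diff, hc, pull_pull]
    rfl

theorem diesOn_pull {χ : G →* AddMonoid.End A} {c : NestedFun G A (n + 1)} {p : H →* G}
    {q : K →* H} : DiesOn (χ.comp p) (pull A p (n + 1) c) q ↔ DiesOn χ c (p.comp q) := by
  rw [DiesOn, DiesOn, MonoidHom.comp_assoc, pull_pull]
  rfl

end Action

end NestedFun

end GaloisSplitting

namespace GaloisSplitting

/-! ### Finite groups on which a cocycle dies -/

open NestedFun

section Extension

variable {Q A : Type u} [Group Q] [AddCommGroup A] {m : ℕ}

/-- For a group `Q`, a `Q`-module `A` and a cochain `x`, the group of pairs `(q, y)` with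
`dy = q x - x`. If `dx` is invariant, this is an extension of `Q` by the module of cocycles `y`, and
iterated connecting homomorphisms send the class of this extension to the class of `dx`. -/
@[ext]
structure CochainExtension (χ : Q →* AddMonoid.End A) (x : NestedFun Q A (m + 1)) where
  base : Q
  cochain : NestedFun Q A m
  diff_cochain : diff Q A m cochain = act χ base (m + 1) x - x

namespace CochainExtension

variable {χ : Q →* AddMonoid.End A} {x : NestedFun Q A (m + 1)}

instance : One (CochainExtension χ x) := ⟨⟨1, 0, by rw [map_zero, act_one, sub_self]⟩⟩

instance : Mul (CochainExtension χ x) :=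
  ⟨fun a b => ⟨a.base * b.base, a.cochain + act χ a.base m b.cochain, by
    rw [map_add, ← act_diff, a.diff_cochain, b.diff_cochain, map_sub, act_mul]
    abel⟩⟩

instance : Inv (CochainExtension χ x) :=
  ⟨fun a => ⟨a.base⁻¹, -act χ a.base⁻¹ m a.cochain, by
    rw [map_neg, ← act_diff, a.diff_cochain, map_sub, ← act_mul, inv_mul_cancel, act_one]
    abel⟩⟩

theorem mul_base (a b : CochainExtension χ x) : (a * b).base = a.base * b.base := rfl

theorem mul_cochain (a b : CochainExtension χ x) :
    (a * b).cochain = a.cochain + act χ a.base m b.cochain := rfl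

instance : Group (CochainExtension χ x) :=
  Group.ofLeftAxioms
    (fun a b c => CochainExtension.ext (mul_assoc _ _ _) (by
      simp only [mul_cochain, mul_base, map_add, act_mul, add_assoc]))
    (fun a => CochainExtension.ext (one_mul _) (by
      change 0 + act χ 1 m a.cochain = a.cochain
      rw [act_one, zero_add]))
    (fun a => CochainExtension.ext (inv_mul_cancel _) (by
      change -act χ a.base⁻¹ m a.cochain + act χ a.base⁻¹ m a.cochain = 0
      rw [neg_add_cancel]))

instance [Finite Q] [Finite A] : Finite (CochainExtension χ x) :=
  Finite.of_injective (fun a => (a.base, a.cochain)) fun _ _ h =>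
    CochainExtension.ext (congrArg Prod.fst h) (congrArg Prod.snd h)

variable (χ x) in
/-- The projection to `Q`. -/
def proj : CochainExtension χ x →* Q where
  toFun := base
  map_one' := rfl
  map_mul' _ _ := rfl

theorem proj_surjective (hx : ∀ q, act χ q (m + 2) (diff Q A (m + 1) x) = diff Q A (m + 1) x) :
    Function.Surjective (proj χ x) := fun q =>
  ⟨⟨q, (act χ q (m + 1) x - x) 1, diff_eval 1 _ (by
    rw [map_sub, ← act_diff, hx, sub_self])⟩, rfl⟩

end CochainExtension

/-- On the extension, the failure of `x` to be invariant is the coboundary of the tautological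
crossed homomorphism `(q, y) ↦ y`. As a function on the extension, the latter is the coboundary of
`w : e = (q, y) ↦ y(e)`, so that `x + dw` is invariant. -/
theorem diesOn_cochainExtension_proj (χ : Q →* AddMonoid.End A) (x : NestedFun Q A (m + 2)) :
    DiesOn χ (diff Q A (m + 2) x) (CochainExtension.proj χ x) := by
  set p := CochainExtension.proj χ x
  let w : NestedFun (CochainExtension χ x) A (m + 1) := fun e => pull A p (m + 1) e.cochain e
  have hw : ∀ e : CochainExtension χ x,
      act (χ.comp p) e (m + 1) w = w - pull A p (m + 1) e.cochain := by
    intro e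
    funext e'
    have h : (e * (e⁻¹ * e')).cochain = e'.cochain := by rw [mul_inv_cancel_left]
    rw [CochainExtension.mul_cochain, ← eq_sub_iff_add_eq'] at h
    change act (χ.comp p) e (m + 1) (pull A p (m + 1) (e⁻¹ * e').cochain) e' = _
    rw [act_pull]
    change pull A p (m + 1) (act χ e.base (m + 1) (e⁻¹ * e').cochain) e' = _
    rw [h, map_sub]
    rfl
  refine ⟨pull A p (m + 2) x + diff _ A (m + 1) w, fun e => ?_, ?_⟩
  · have h : act χ (p e) (m + 2) x = diff Q A (m + 1) e.cochain + x := by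
      rw [e.diff_cochain, sub_add_cancel]
      rfl
    rw [map_add, act_pull, act_diff, hw, map_sub, h, map_add, ← pull_diff]
    abel
  · rw [map_add, diff_diff, add_zero, pull_diff]

/-- If `j : H → Q` is injective and `dx` dies on `H`, then it is already the differential of an
`H`-invariant cochain of `Q`; this provides a lift of `j` to the extension. -/
theorem exists_lift_cochainExtension {H : Type u} [Group H] (χ : Q →* AddMonoid.End A)
    (x : NestedFun Q A (m + 1))
    (hx : ∀ q, act χ q (m + 2) (diff Q A (m + 1) x) = diff Q A (m + 1) x) (j : H →* Q)
    (hj : Function.Injective j) (h : DiesOn χ (diff Q A (m + 1) x) j) :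
    ∃ j' : H →* CochainExtension χ x, (CochainExtension.proj χ x).comp j' = j := by
  obtain ⟨φ, hφ, hd⟩ := h
  -- an `H`-equivariant map `r : Q → H`, which exists because `H` acts freely on `Q`
  obtain ⟨r, hr⟩ : ∃ r : Q → H, ∀ h q, r (j h * q) = h * r q := by
    let s : Q → Q := fun q => (Quotient.out (s := QuotientGroup.rightRel j.range)
      (Quotient.mk _ q))
    have hs : ∀ q, ∃ h, j h * s q = q := by
      intro q
      have := Quotient.exact (Quotient.out_eq (s := QuotientGroup.rightRel j.range)
        (Quotient.mk _ q))
      exact (QuotientGroup.rightRel_apply.1 this).imp fun h hh => by rw [hh]; simp [s]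
    choose r hr using hs
    refine ⟨r, fun h q => hj ?_⟩
    have hsq : s (j h * q) = s q := by
      have : (Quotient.mk (QuotientGroup.rightRel j.range) (j h * q)) = Quotient.mk _ q := by
        exact Quotient.sound (QuotientGroup.rightRel_apply.2 ⟨h⁻¹, by simp⟩)
      simp only [s, this]
    have h1 := hr (j h * q)
    rw [hsq, ← eq_mul_inv_iff_mul_eq] at h1
    have h2 := hr q
    rw [← eq_mul_inv_iff_mul_eq] at h2
    rw [h1, map_mul, h2, mul_assoc]
  -- `φ` extended along `r` has differential `(j ∘ r)^* c`; the prism operator corrects this to `c`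
  set c := diff Q A (m + 1) x
  let x' : NestedFun Q A (m + 1) := pull A r (m + 1) φ - prism A id (j ∘ r) (m + 1) c
  have hx' : diff Q A (m + 1) x' = c := by
    have h1 := diff_prism_add_prism_diff id (j ∘ r) c
    have h2 : pull A id (m + 2) c = c := transport_id c
    rw [diff_diff, map_zero, add_zero, h2, ← pull_pull, ← hd, pull_diff] at h1
    rw [map_sub, h1, sub_sub_cancel]
  have hinv : ∀ h, act χ (j h) (m + 1) x' = x' := by
    intro h
    have h1 : act χ (j h) (m + 1) (pull A r (m + 1) φ) = pull A r (m + 1) φ := by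
      conv_rhs => rw [← hφ h]
      unfold act pull
      rw [transport_transport, transport_transport]
      congr 2
      funext q
      have := hr h⁻¹ q
      rw [map_inv] at this
      exact this
    have h2 : act χ (j h) (m + 1) (prism A id (j ∘ r) (m + 1) c) =
        prism A id (j ∘ r) (m + 1) c := by
      conv_rhs => rw [← hx (j h)]
      unfold act
      refine transport_prism (coeff χ (j h)) id (j ∘ r) ((j h)⁻¹ * ·) ((j h)⁻¹ * ·) rfl ?_ c
      funext q
      have := hr h⁻¹ q
      rw [map_inv] at this
      simp [this]
    rw [map_sub, h1, h2]
  -- `x' - x = dz`, so `z - (j h) z` has differential `(j h) x - x`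
  have hz := diff_eval 1 (x' - x) (by rw [map_sub, hx', sub_self])
  set z := (x' - x) 1
  refine ⟨MonoidHom.mk' (fun h => ⟨j h, z - act χ (j h) m z, ?_⟩) fun a b => ?_, rfl⟩
  · rw [map_sub, ← act_diff, hz, map_sub, hinv]
    abel
  · refine CochainExtension.ext (map_mul j a b) ?_
    change z - act χ (j (a * b)) m z = z - act χ (j a) m z + act χ (j a) m (z - act χ (j b) m z)
    rw [map_mul, act_mul, map_sub]
    abel

end Extension

end GaloisSplitting

namespace GaloisSplitting

open NestedFun

theorem injective_toPermHom (H : Type u) [Group H] :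
    Function.Injective (MulAction.toPermHom H H) := MulAction.toPerm_injective

section Tower

variable {G A : Type u} [Group G] [AddCommGroup A] {n : ℕ}

/-- A finite group with a surjection to `G` on which the cocycle `c` dies. -/
structure SplittingGroup (χ : G →* AddMonoid.End A) (c : NestedFun G A (n + 1)) where
  carrier : Type u
  [group : Group carrier]
  [finite : Finite carrier]
  proj : carrier →* G
  proj_surjective : Function.Surjective proj
  dies : DiesOn χ c proj

attribute [instance] SplittingGroup.group SplittingGroup.finite

variable {m : ℕ} [Finite G] [Finite A] (χ : G →* AddMonoid.End A)
  {c : NestedFun G A (m + 3)}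

/-- The group is the cochain extension of `G × Perm Y` by the inflation of `c`; every group `H → G`
that acts faithfully on `Y` is a subgroup of `G × Perm Y`. -/
theorem exists_splittingGroup (hc : ∀ g, act χ g (m + 3) c = c) (hd : diff G A (m + 3) c = 0)
    (Y : Type u) [Finite Y] : ∃ E : SplittingGroup χ c,
      ∀ (H : Type u) [Group H] (p : H →* G) (i : H →* Equiv.Perm Y), Function.Injective i →
        DiesOn χ c p → ∃ j : H →* E.carrier, Function.Injective j ∧ E.proj.comp j = p := by
  let q : G × Equiv.Perm Y →* G := MonoidHom.fst _ _
  let ψ := χ.comp q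
  let c' := pull A q (m + 3) c
  let x := c' 1
  have hx : diff _ A (m + 2) x = c' := diff_eval 1 c' (by rw [← pull_diff, hd, map_zero])
  have hc' : ∀ a, act ψ a (m + 3) c' = c' := fun a => by rw [act_pull, hc]
  have hinv : ∀ a, act ψ a (m + 3) (diff _ A (m + 2) x) = diff _ A (m + 2) x := by rwa [hx]
  refine ⟨⟨CochainExtension ψ x, q.comp (CochainExtension.proj ψ x), ?_, ?_⟩, ?_⟩
  · exact (Prod.fst_surjective).comp (CochainExtension.proj_surjective hinv)
  · have := diesOn_cochainExtension_proj ψ x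
    rw [hx] at this
    exact diesOn_pull.1 this
  · intro H _ p i hi hp
    have hj : Function.Injective (p.prod i) := fun a b h => hi (congrArg Prod.snd h)
    obtain ⟨j', hj'⟩ := exists_lift_cochainExtension ψ x hinv (p.prod i) hj (by
      rw [hx]
      exact diesOn_pull.2 hp)
    refine ⟨j', fun a b h => hj ?_, ?_⟩
    · rw [← hj', MonoidHom.comp_apply, h, MonoidHom.comp_apply]
    · rw [MonoidHom.comp_assoc, hj']
      rfl

/-- There is an increasing sequence of groups through which every finite group over `G` on which `c`
dies factors. -/
theorem exists_splittingGroup_tower (hc : ∀ g, act χ g (m + 3) c = c)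
    (hd : diff G A (m + 3) c = 0) : ∃ E : ℕ → SplittingGroup χ c,
      (∀ i, ∃ j : (E i).carrier →* (E (i + 1)).carrier, Function.Injective j ∧
        (E (i + 1)).proj.comp j = (E i).proj) ∧
      ∀ (H : Type u) [Group H] [Finite H] (p : H →* G), DiesOn χ c p →
        ∃ i, ∃ j : H →* (E i).carrier, (E i).proj.comp j = p := by
  choose F hF using fun (Y : Type u) (hY : Finite Y) => exists_splittingGroup χ hc hd Y
  obtain ⟨E, hE⟩ : ∃ E : ℕ → SplittingGroup χ c, ∀ i,
      E (i + 1) = F ((E i).carrier ⊕ ULift (Fin i)) inferInstance :=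
    ⟨fun i => i.rec (F PEmpty inferInstance)
      fun i E => F (E.carrier ⊕ ULift (Fin i)) inferInstance, fun _ => rfl⟩
  have key : ∀ (i : ℕ) (H : Type u) [Group H] (p : H →* G)
      (f : H →* Equiv.Perm ((E i).carrier ⊕ ULift.{u} (Fin i))), Function.Injective f →
      DiesOn χ c p → ∃ j : H →* (E (i + 1)).carrier, Function.Injective j ∧
        (E (i + 1)).proj.comp j = p := by
    intro i H _ p f hf hp
    rw [hE]
    exact hF _ _ H p f hf hp
  refine ⟨E, fun i => ?_, fun H _ _ p hp => ?_⟩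
  · exact key i (E i).carrier (E i).proj ((Equiv.Perm.sumCongrHom _ _).comp
      ((MonoidHom.inl _ _).comp (MulAction.toPermHom (E i).carrier (E i).carrier)))
      ((Equiv.Perm.sumCongrHom_injective.comp
        (Prod.mk_left_injective (1 : Equiv.Perm (ULift.{u} (Fin i))))).comp
          (injective_toPermHom (E i).carrier)) (E i).dies
  · let e : H ≃ ULift.{u} (Fin (Nat.card H)) := (Finite.equivFin H).trans Equiv.ulift.symm
    obtain ⟨j, -, hj⟩ := key (Nat.card H) H p
      ((Equiv.Perm.sumCongrHom _ _).comp ((MonoidHom.inr _ _).comp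
        (e.permCongrHom.toMonoidHom.comp (MulAction.toPermHom H H))))
      ((Equiv.Perm.sumCongrHom_injective.comp
        (Prod.mk_right_injective (1 : Equiv.Perm (E (Nat.card H)).carrier))).comp
        (e.permCongrHom.injective.comp (injective_toPermHom H))) hp
    exact ⟨Nat.card H + 1, j, hj⟩

end Tower

end GaloisSplitting

namespace GaloisSplitting

open TensorProduct KaehlerDifferential

/-! ### Descent of smoothness along étale extensions -/

section SmoothDescent

/-- For a base change `T = R ⊗[P] Q` of a formally étale flat map `P → Q`, the first cotangent
homology of `T` over `A` is the base change of the one of `R`. -/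
theorem nonempty_tensorH1Cotangent_equiv {A R T : Type u} [CommRing A] [CommRing R] [CommRing T]
    [Algebra A R] [Algebra A T] [Algebra R T] [IsScalarTower A R T] [Module.Flat R T]
    (P : Algebra.Extension.{u} A R) [Algebra.FormallySmooth A P.Ring]
    (Q : Type u) [CommRing Q] [Algebra P.Ring Q] [Algebra.FormallyEtale P.Ring Q]
    [Module.Flat P.Ring Q] [Algebra Q T] [Algebra P.Ring T] [IsScalarTower P.Ring R T]
    [IsScalarTower P.Ring Q T]
    (h : Function.Bijective (Algebra.TensorProduct.lift (IsScalarTower.toAlgHom P.Ring Q T)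
      (IsScalarTower.toAlgHom P.Ring R T) fun _ _ => .all _ _)) :
    Nonempty (T ⊗[R] Algebra.H1Cotangent A R ≃ₗ[T] Algebra.H1Cotangent A T) := by
  let _ : Algebra A Q := ((algebraMap P.Ring Q).comp (algebraMap A P.Ring)).toAlgebra
  have : IsScalarTower A P.Ring Q := .of_algebraMap_eq' rfl
  have : IsScalarTower A Q T := .of_algebraMap_eq fun a => by
    rw [IsScalarTower.algebraMap_apply A P.Ring Q, ← IsScalarTower.algebraMap_apply P.Ring Q T,
      IsScalarTower.algebraMap_apply P.Ring R T, ← IsScalarTower.algebraMap_apply A P.Ring R,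
      ← IsScalarTower.algebraMap_apply A R T]
  have hsurj : Function.Surjective (algebraMap Q T) := by
    intro t
    obtain ⟨y, rfl⟩ := h.2 t
    induction y with
    | zero => exact ⟨0, by simp⟩
    | add a b ha hb =>
      obtain ⟨a', ha⟩ := ha
      obtain ⟨b', hb⟩ := hb
      exact ⟨a' + b', by rw [map_add, map_add, ha, hb]⟩
    | tmul q r =>
      obtain ⟨p, rfl⟩ := P.algebraMap_surjective r
      refine ⟨q * algebraMap P.Ring Q p, ?_⟩
      rw [map_mul, ← IsScalarTower.algebraMap_apply P.Ring Q T]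
      simp
  let Q' : Algebra.Extension.{u} A T :=
    { Ring := Q
      σ := Function.surjInv hsurj
      algebraMap_σ := Function.surjInv_eq hsurj }
  have : Algebra.FormallySmooth A Q'.Ring := .comp A P.Ring Q
  let f : P.Hom Q' :=
    { toRingHom := algebraMap P.Ring Q
      toRingHom_algebraMap := fun a => (IsScalarTower.algebraMap_apply A P.Ring Q a).symm
      algebraMap_toRingHom := fun p => by
        change algebraMap Q T (algebraMap P.Ring Q p) = _
        rw [← IsScalarTower.algebraMap_apply P.Ring Q T, IsScalarTower.algebraMap_apply P.Ring R T] }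
  let _ : Algebra P.Ring Q'.Ring := inferInstanceAs (Algebra P.Ring Q)
  have hf : algebraMap P.Ring Q'.Ring = f.toRingHom := rfl
  -- the kernel of `Q → T` is the base change of the kernel of `P → R`, by flatness
  have hk : Function.Bijective ((f.mapKer hf).liftBaseChange Q'.Ring) := by
    have hcomp : (Submodule.subtype Q'.ker).restrictScalars Q ∘ₗ
        ((f.mapKer hf).liftBaseChange Q'.Ring) =
        (AlgebraTensorModule.rid P.Ring Q Q).toLinearMap ∘ₗ
          AlgebraTensorModule.lTensor Q Q P.ker.subtype := by
      ext x
      change (1 : Q) • algebraMap P.Ring Q x = (x : P.Ring) • (1 : Q)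
      rw [one_smul, Algebra.smul_def, mul_one]
    constructor
    · have hinj : Function.Injective ((AlgebraTensorModule.rid P.Ring Q Q).toLinearMap ∘ₗ
          AlgebraTensorModule.lTensor Q Q P.ker.subtype) :=
        (AlgebraTensorModule.rid P.Ring Q Q).injective.comp
          (Module.Flat.lTensor_preserves_injective_linearMap _ P.ker.injective_subtype)
      rw [← hcomp] at hinj
      exact fun a b hab => hinj (congrArg Subtype.val hab)
    · rintro ⟨y, hy⟩
      have hy0 : (y ⊗ₜ[P.Ring] (1 : R) : Q ⊗[P.Ring] R) = 0 := by
        refine h.1 ?_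
        rw [map_zero]
        have : algebraMap Q T y = 0 := hy
        simp [this]
      have hex := lTensor_exact Q (f := P.ker.subtype) (g := Algebra.linearMap P.Ring R)
        (fun p => ⟨fun hp => ⟨⟨p, hp⟩, rfl⟩, by
          rintro ⟨⟨p, hp⟩, rfl⟩
          exact hp⟩) P.algebraMap_surjective
      obtain ⟨z, hz⟩ := (hex (y ⊗ₜ 1)).1 (by simpa using hy0)
      refine ⟨z, Subtype.ext ?_⟩
      have := congr($hcomp z)
      refine this.trans ?_
      change AlgebraTensorModule.rid P.Ring Q Q (LinearMap.lTensor Q P.ker.subtype z) = y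
      rw [hz]
      simp
  have e₁ : T ⊗[R] P.H1Cotangent ≃ₗ[T] Q'.H1Cotangent :=
    Algebra.Extension.tensorH1CotangentOfFormallyEtale f hf
      (by change (algebraMap P.Ring Q).FormallyEtale; rwa [RingHom.formallyEtale_algebraMap]) hk
  exact ⟨(LinearEquiv.baseChange R T _ _ P.equivH1CotangentOfFormallySmooth).symm ≪≫ₗ e₁ ≪≫ₗ
    Q'.equivH1CotangentOfFormallySmooth⟩

open Polynomial in
theorem exists_monic_lift {P R : Type u} [CommRing P] [CommRing R] (φ : P →+* R)
    (hφ : Function.Surjective φ) (f : R[X]) (hf : f.Monic) : ∃ g : P[X], g.Monic ∧ g.map φ = f := by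
  obtain ⟨g, hg, -, hm⟩ := lifts_and_natDegree_eq_and_monic
    ((Polynomial.mem_lifts f).2 (Polynomial.map_surjective φ hφ f)) hf
  exact ⟨g, hm, hg⟩

open Polynomial in
/-- If `R` is a quotient of a polynomial ring `P` over `A`, then a standard étale `R`-algebra is the
base change of a standard étale `P`-algebra. -/
theorem nonempty_tensorH1Cotangent_equiv_of_isStandardEtale {A R T : Type u} [CommRing A]
    [CommRing R] [CommRing T] [Algebra A R] [Algebra A T] [Algebra R T] [IsScalarTower A R T]
    [Algebra.IsStandardEtale R T] :
    Nonempty (T ⊗[R] Algebra.H1Cotangent A R ≃ₗ[T] Algebra.H1Cotangent A T) := by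
  let P : Algebra.Extension.{u} A R := (Algebra.Generators.self A R).toExtension
  have : Algebra.FormallySmooth A P.Ring :=
    inferInstanceAs (Algebra.FormallySmooth A (MvPolynomial R A))
  obtain ⟨E⟩ := Algebra.IsStandardEtale.nonempty_standardEtalePresentation (R := R) (S := T)
  let φ := algebraMap P.Ring R
  have hφ : Function.Surjective φ := P.algebraMap_surjective
  obtain ⟨p₁, p₂, n, hE⟩ := E.cond
  obtain ⟨f, hfm, hf⟩ := exists_monic_lift φ hφ E.f E.monic_f
  obtain ⟨q₁, hq₁⟩ := Polynomial.map_surjective φ hφ (p₁ * E.g)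
  obtain ⟨q₂, hq₂⟩ := Polynomial.map_surjective φ hφ (p₂ * E.g)
  -- the polynomial to be inverted is chosen so that the condition on the derivative lifts
  let F : StandardEtalePair P.Ring :=
    { f := f
      monic_f := hfm
      g := derivative f * q₁ + f * q₂
      cond := ⟨q₁, q₂, 1, (pow_one _).symm⟩ }
  have hg : F.g.map φ = E.g ^ (n + 1) := by
    simp only [F, Polynomial.map_add, Polynomial.map_mul, hq₁, hq₂, ← Polynomial.derivative_map, hf]
    rw [pow_succ, ← hE]
    ring
  let _ : Algebra P.Ring T := ((algebraMap R T).comp φ).toAlgebra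
  have : IsScalarTower P.Ring R T := .of_algebraMap_eq' rfl
  have hmap : F.HasMap E.x := by
    constructor
    · rw [← Polynomial.aeval_map_algebraMap R, show F.f.map (algebraMap P.Ring R) = E.f from hf]
      exact E.hasMap.1
    · rw [← Polynomial.aeval_map_algebraMap R, show F.g.map (algebraMap P.Ring R) = _ from hg,
        map_pow]
      exact E.hasMap.2.pow _
  let _ : Algebra F.Ring T := (F.lift E.x hmap).toAlgebra
  have : IsScalarTower P.Ring F.Ring T := .of_algebraMap_eq' (F.lift E.x hmap).comp_algebraMap.symm
  have : Algebra.Etale P.Ring F.Ring := inferInstance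
  have : Module.Flat P.Ring F.Ring := Algebra.Smooth.flat _ _
  have : Algebra.Etale R T := inferInstance
  have : Module.Flat R T := Algebra.Smooth.flat _ _
  refine nonempty_tensorH1Cotangent_equiv P F.Ring ?_
  set ψ := Algebra.TensorProduct.lift (IsScalarTower.toAlgHom P.Ring F.Ring T)
    (IsScalarTower.toAlgHom P.Ring R T) fun _ _ => .all _ _ with hψ
  let _ : Algebra R (F.Ring ⊗[P.Ring] R) := Algebra.TensorProduct.rightAlgebra
  have hmap' : E.HasMap (F.X ⊗ₜ 1 : F.Ring ⊗[P.Ring] R) := by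
    have hX := F.hasMap_X.map (Algebra.TensorProduct.includeLeft :
      F.Ring →ₐ[P.Ring] F.Ring ⊗[P.Ring] R)
    have : IsScalarTower P.Ring R (F.Ring ⊗[P.Ring] R) := inferInstance
    constructor
    · rw [show E.f = F.f.map (algebraMap P.Ring R) from hf.symm, Polynomial.aeval_map_algebraMap]
      exact hX.1
    · refine (isUnit_pow_iff n.succ_ne_zero).1 ?_
      rw [← map_pow, show E.g ^ n.succ = F.g.map (algebraMap P.Ring R) from hg.symm,
        Polynomial.aeval_map_algebraMap]
      exact hX.2
  let ψ' : F.Ring ⊗[P.Ring] R →ₐ[R] T :=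
    { ψ with
      commutes' := fun r => by
        change ψ (1 ⊗ₜ r) = _
        simp [hψ] }
  have hψX : ψ' (F.X ⊗ₜ 1) = E.x := by
    change ψ (F.X ⊗ₜ 1) = E.x
    simp only [hψ, Algebra.TensorProduct.lift_tmul, map_one, mul_one]
    exact F.lift_X E.x hmap
  let θ : T →ₐ[R] F.Ring ⊗[P.Ring] R := (E.lift _ hmap').comp E.equivRing.toAlgHom
  have hθx : θ E.x = F.X ⊗ₜ 1 := by simp [θ]
  have h1 : ψ'.comp θ = .id R T := E.hom_ext (by simp [hθx, hψX])
  have h2 : (θ.restrictScalars P.Ring).comp (ψ'.restrictScalars P.Ring) = .id P.Ring _ := by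
    refine Algebra.TensorProduct.ext (F.hom_ext ?_) (AlgHom.ext fun r => ?_)
    · change θ (ψ' (F.X ⊗ₜ 1)) = F.X ⊗ₜ 1
      rw [hψX, hθx]
    · exact (θ.comp ψ').commutes r
  exact ⟨fun a b hab => by
    have := congrArg θ (show ψ' a = ψ' b from hab)
    rwa [show θ (ψ' a) = a from congr($h2 a), show θ (ψ' b) = b from congr($h2 b)] at this,
    fun t => ⟨θ t, congr($h1 t)⟩⟩

/-- Smoothness descends along a faithfully flat étale map of the source. The cotangent homology of
`R` vanishes because étale-locally it is computed by standard étale algebras. -/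
theorem smooth_of_etale_of_faithfullyFlat (A R S : Type u) [CommRing A] [CommRing R] [CommRing S]
    [Algebra A R] [Algebra A S] [Algebra R S] [IsScalarTower A R S] [Algebra.FinitePresentation A R]
    [Algebra.Etale R S] [Module.FaithfullyFlat R S] [Algebra.Smooth A S] : Algebra.Smooth A R := by
  refine ⟨?_, inferInstance⟩
  rw [Algebra.formallySmooth_iff]
  constructor
  · have : Module.Flat S (S ⊗[R] Ω[R⁄A]) :=
      .of_linearEquiv (KaehlerDifferential.tensorKaehlerEquivOfFormallyEtale A R S)
    have : Module.Flat R Ω[R⁄A] := Module.Flat.of_flat_tensorProduct _ _ S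
    exact Module.Flat.projective_of_finitePresentation
  · have : Subsingleton (S ⊗[R] Algebra.H1Cotangent A R) := by
      rw [← Module.support_eq_empty_iff (R := S), Set.eq_empty_iff_forall_notMem]
      intro q
      rw [Module.notMem_support_iff']
      intro x
      obtain ⟨f, hf, hS⟩ := Algebra.IsEtaleAt.exists_isStandardEtale (R := R) q.asIdeal
      obtain ⟨e⟩ := nonempty_tensorH1Cotangent_equiv_of_isStandardEtale (A := A) (R := R)
        (T := Localization.Away f)
      have : Algebra.FormallySmooth A (Localization.Away f) := .comp A S _
      have : Subsingleton (Localization.Away f ⊗[R] Algebra.H1Cotangent A R) := e.subsingleton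
      have : Subsingleton (Localization.Away f ⊗[S] (S ⊗[R] Algebra.H1Cotangent A R)) :=
        (AlgebraTensorModule.cancelBaseChange R S S (Localization.Away f)
          (Algebra.H1Cotangent A R)).subsingleton
      obtain ⟨⟨_, n, rfl⟩, hc⟩ := (IsLocalizedModule.eq_zero_iff (Submonoid.powers f)
        (TensorProduct.mk S (Localization.Away f) (S ⊗[R] Algebra.H1Cotangent A R) 1)).1
          (Subsingleton.elim (TensorProduct.mk S (Localization.Away f) _ 1 x) 0)
      exact ⟨f ^ n, fun h => hf (q.2.mem_of_pow_mem n h), hc⟩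
    exact Module.FaithfullyFlat.lTensor_reflects_triviality R S (Algebra.H1Cotangent A R)

end SmoothDescent

end GaloisSplitting

namespace GaloisSplitting

open TensorProduct

/-! ### Galois extensions of rings -/

section GaloisRing

variable {k S E : Type u} [CommRing k] [CommRing S] [Algebra k S] [Group E]

/-- The subalgebra of elements fixed by a group of algebra endomorphisms. -/
def fixedSubalgebra (ρ : E →* (S →ₐ[k] S)) : Subalgebra k S where
  carrier := {s | ∀ e, ρ e s = s}
  mul_mem' ha hb e := by rw [map_mul, ha e, hb e]
  add_mem' ha hb e := by rw [map_add, ha e, hb e]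
  algebraMap_mem' r e := (ρ e).commutes r

variable (ρ : E →* (S →ₐ[k] S))

section Trace

variable [Fintype E]

/-- The trace to the subalgebra of fixed elements. -/
def fixedTrace : S →ₗ[fixedSubalgebra ρ] fixedSubalgebra ρ where
  toFun s := ⟨∑ e, ρ e s, fun e' => by
    rw [map_sum]
    refine Fintype.sum_equiv (Equiv.mulLeft e') _ _ fun e => ?_
    rw [Equiv.coe_mulLeft, map_mul]
    rfl⟩
  map_add' s t := Subtype.ext (by simp [Finset.sum_add_distrib])
  map_smul' r s := Subtype.ext (by
    simp only [Subalgebra.smul_def, smul_eq_mul, map_mul, RingHom.id_apply, Finset.mul_sum,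
      Subalgebra.coe_mul]
    exact Finset.sum_congr rfl fun e _ => by rw [r.2 e])

theorem coe_fixedTrace (s : S) : (fixedTrace ρ s : S) = ∑ e, ρ e s := rfl

end Trace

variable {ι : Type u} [Fintype ι]

/-- Galois coordinates: families `a`, `b` with `∑ aᵢ e(bᵢ) = 0` for `e ≠ 1` and `∑ aᵢ bᵢ = 1`. They
express that the group acts freely on the spectrum, i.e. that the ring is a Galois extension of the
fixed subalgebra. -/
structure IsGaloisCoordinates (a b : ι → S) : Prop where
  sum_mul : ∑ i, a i * b i = 1
  sum_mul_of_ne : ∀ e, e ≠ 1 → ∑ i, a i * ρ e (b i) = 0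

variable {ρ} {a b : ι → S}

theorem IsGaloisCoordinates.symm (h : IsGaloisCoordinates ρ a b) : IsGaloisCoordinates ρ b a := by
  refine ⟨by simpa only [mul_comm] using h.sum_mul, fun e he => ?_⟩
  have := congrArg (ρ e) (h.sum_mul_of_ne e⁻¹ (inv_ne_one.2 he))
  have hee : ∀ s, ρ e (ρ e⁻¹ s) = s := fun s => by
    rw [← AlgHom.mul_apply, ← map_mul, mul_inv_cancel, map_one, AlgHom.one_apply]
  simpa only [map_sum, map_mul, hee, map_zero, mul_comm] using this

theorem eq_of_comp_eq_of_isGaloisCoordinates (h : IsGaloisCoordinates ρ a b) {Ω : Type u} [CommRing Ω] [Nontrivial Ω]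
    (t : S →+* Ω) (e e' : E) (he : ∀ y, t (ρ e y) = t (ρ e' y)) : e = e' := by
  by_contra hne
  have h2 := h.sum_mul_of_ne (e⁻¹ * e') (by rwa [ne_eq, inv_mul_eq_one])
  have h3 : ∀ y, ρ e (ρ (e⁻¹ * e') y) = ρ e' y := fun y => by
    rw [← AlgHom.mul_apply, ← map_mul, mul_inv_cancel_left]
  have h4 := congrArg (fun y => t (ρ e y)) h2
  have h5 := congrArg (fun y => t (ρ e y)) h.sum_mul
  simp only [map_sum, map_mul t, map_mul (ρ e), map_zero, h3, map_one t, map_one (ρ e)] at h4 h5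
  simp only [he] at h4 h5
  exact one_ne_zero (h5.symm.trans h4)

variable [Fintype E]

theorem sum_trace_mul (h : IsGaloisCoordinates ρ a b) (s : S) :
    ∑ i, a i * fixedTrace ρ (b i * s) = s := by
  classical
  simp only [coe_fixedTrace, Finset.mul_sum, map_mul]
  rw [Finset.sum_comm, Finset.sum_eq_single 1]
  · simp only [map_one, AlgHom.one_apply, ← mul_assoc, ← Finset.sum_mul, h.sum_mul, one_mul]
  · intro e _ he
    simp only [← mul_assoc, ← Finset.sum_mul, h.sum_mul_of_ne e he, zero_mul]
  · simp

theorem sum_smul_of_isGaloisCoordinates (h : IsGaloisCoordinates ρ a b) (s : S) : ∑ i, fixedTrace ρ (b i * s) • a i = s := by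
  simp only [Subalgebra.smul_def, smul_eq_mul, mul_comm _ (a _)]
  exact sum_trace_mul h s

/-- The linear maps of a dual basis express `S` as a direct summand of a free module. -/
theorem exists_split_of_isGaloisCoordinates (h : IsGaloisCoordinates ρ a b) :
    ∃ (i : S →ₗ[fixedSubalgebra ρ] (ι → fixedSubalgebra ρ))
      (p : (ι → fixedSubalgebra ρ) →ₗ[fixedSubalgebra ρ] S), p ∘ₗ i = LinearMap.id := by
  refine ⟨LinearMap.pi fun i => fixedTrace ρ ∘ₗ LinearMap.mulLeft _ (b i),
    Fintype.linearCombination _ a, LinearMap.ext fun s => ?_⟩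
  simpa [Fintype.linearCombination_apply] using sum_smul_of_isGaloisCoordinates h s

theorem finite_of_isGaloisCoordinates (h : IsGaloisCoordinates ρ a b) : Module.Finite (fixedSubalgebra ρ) S := by
  obtain ⟨i, p, hp⟩ := exists_split_of_isGaloisCoordinates h
  exact Module.Finite.of_surjective p fun s => ⟨i s, congr($hp s)⟩

theorem projective_of_isGaloisCoordinates (h : IsGaloisCoordinates ρ a b) : Module.Projective (fixedSubalgebra ρ) S := by
  obtain ⟨i, p, hp⟩ := exists_split_of_isGaloisCoordinates h
  exact .of_split i p hp

theorem faithfullyFlat_of_isGaloisCoordinates (h : IsGaloisCoordinates ρ a b) :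
    Module.FaithfullyFlat (fixedSubalgebra ρ) S := by
  have := finite_of_isGaloisCoordinates h
  have := projective_of_isGaloisCoordinates h
  exact .of_comap_surjective (Algebra.IsIntegral.comap_surjective _ _)

/-- The element `∑ aᵢ ⊗ bᵢ` generates the idempotent of the diagonal. -/
theorem formallyUnramified_of_isGaloisCoordinates (h : IsGaloisCoordinates ρ a b) :
    Algebra.FormallyUnramified (fixedSubalgebra ρ) S := by
  have := finite_of_isGaloisCoordinates h
  refine Algebra.FormallyUnramified.iff_exists_tensorProduct.2 ⟨∑ i, a i ⊗ₜ b i, fun s => ?_, ?_⟩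
  · rw [sub_mul, sub_eq_zero, Finset.mul_sum, Finset.mul_sum]
    simp only [Algebra.TensorProduct.tmul_mul_tmul, one_mul]
    calc ∑ i, a i ⊗ₜ[fixedSubalgebra ρ] (s * b i)
        = ∑ i, a i ⊗ₜ[fixedSubalgebra ρ] ∑ j, fixedTrace ρ (a j * (s * b i)) • b j := by
          simp only [sum_smul_of_isGaloisCoordinates h.symm]
      _ = ∑ j, (∑ i, fixedTrace ρ (b i * (s * a j)) • a i) ⊗ₜ[fixedSubalgebra ρ] b j := by
          simp only [tmul_sum, sum_tmul, tmul_smul, smul_tmul']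
          rw [Finset.sum_comm]
          refine Finset.sum_congr rfl fun j _ => Finset.sum_congr rfl fun i _ => ?_
          rw [show a j * (s * b i) = b i * (s * a j) by ring]
      _ = ∑ i, (s * a i) ⊗ₜ[fixedSubalgebra ρ] b i := by
          simp only [sum_smul_of_isGaloisCoordinates h]
  · simpa [map_sum] using h.sum_mul

/-- Two homomorphisms to a domain that agree on the fixed elements are conjugate, by the linear
independence of characters. -/
theorem exists_eq_comp_of_isGaloisCoordinates (h : IsGaloisCoordinates ρ a b) {Ω : Type u} [CommRing Ω] [IsDomain Ω]
    (s t : S →+* Ω) (hst : ∀ r : fixedSubalgebra ρ, s r = t r) :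
    ∃ e, ∀ y, s y = t (ρ e y) := by
  classical
  by_contra! hne
  have hF : LinearIndependent Ω fun f : S →* Ω => (f : S → Ω) := linearIndependent_monoidHom S Ω
  let c : E → Ω := fun e => ∑ i, s (a i) * t (ρ e (b i))
  -- applying `s` to the expansion of `y` in the dual basis expresses `s` through conjugates of `t`
  have hs : ∀ y, s y = ∑ e, c e * t (ρ e y) := by
    intro y
    conv_lhs => rw [← sum_trace_mul h y]
    simp only [map_sum, map_mul, hst]
    simp only [coe_fixedTrace, map_sum, map_mul, c, Finset.sum_mul, Finset.mul_sum]
    rw [Finset.sum_comm]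
    exact Finset.sum_congr rfl fun e _ => Finset.sum_congr rfl fun i _ => by ring
  let T : E → (S →* Ω) := fun e => (t : S →* Ω).comp (ρ e : S →* S)
  have hmem : (s : S → Ω) ∈ Submodule.span Ω
      ((fun f : S →* Ω => (f : S → Ω)) '' Set.range T) := by
    have : (s : S → Ω) = ∑ e, c e • (T e : S → Ω) := by
      funext y
      rw [hs, Finset.sum_apply]
      rfl
    rw [this]
    exact Submodule.sum_mem _ fun e _ => Submodule.smul_mem _ _
      (Submodule.subset_span ⟨T e, ⟨e, rfl⟩, rfl⟩)
  have hnot : (s : S →* Ω) ∉ Set.range T := by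
    rintro ⟨e, he⟩
    obtain ⟨y, hy⟩ := hne e
    exact hy (DFunLike.congr_fun he y).symm
  exact hF.notMem_span_image hnot hmem

/-- A point of the fixed subalgebra with values in a field `l` extends to a point of `S` with values
in a separable closure, since the fibre is a nonzero finite étale `l`-algebra. -/
theorem exists_extension_of_isGaloisCoordinates (h : IsGaloisCoordinates ρ a b) {l ls : Type u} [Field l] [Field ls] [Algebra l ls]
    [IsSepClosed ls] (f : fixedSubalgebra ρ →+* l) :
    ∃ s : S →+* ls, ∀ r : fixedSubalgebra ρ, s r = algebraMap l ls (f r) := by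
  let _ : Algebra (fixedSubalgebra ρ) l := f.toAlgebra
  have := finite_of_isGaloisCoordinates h
  have := faithfullyFlat_of_isGaloisCoordinates h
  have := formallyUnramified_of_isGaloisCoordinates h
  obtain ⟨M, hM⟩ := Ideal.exists_maximal (l ⊗[fixedSubalgebra ρ] S)
  let _ := Ideal.Quotient.field M
  have : Algebra.FormallyUnramified l ((l ⊗[fixedSubalgebra ρ] S) ⧸ M) :=
    .of_surjective (Ideal.Quotient.mkₐ l M) Ideal.Quotient.mk_surjective
  have : Algebra.IsSeparable l ((l ⊗[fixedSubalgebra ρ] S) ⧸ M) :=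
    Algebra.FormallyUnramified.isSeparable l _
  let φ : ((l ⊗[fixedSubalgebra ρ] S) ⧸ M) →ₐ[l] ls := IsSepClosed.lift
  refine ⟨(φ : _ →+* ls).comp ((Ideal.Quotient.mk M).comp
    (Algebra.TensorProduct.includeRight : S →ₐ[fixedSubalgebra ρ] _).toRingHom), fun r => ?_⟩
  have hr : (1 : l) ⊗ₜ[fixedSubalgebra ρ] (r : S) = algebraMap l _ (f r) := by
    have h2 : (r : S) = r • (1 : S) := (Algebra.algebraMap_eq_smul_one (A := S) r)
    rw [h2, ← smul_tmul]
    change (f r * 1) ⊗ₜ[fixedSubalgebra ρ] (1 : S) = (f r) ⊗ₜ 1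
    rw [mul_one]
  change φ (Ideal.Quotient.mk M ((1 : l) ⊗ₜ[fixedSubalgebra ρ] (r : S))) = _
  rw [hr]
  exact φ.commutes (f r)

end GaloisRing

end GaloisSplitting

namespace GaloisSplitting

open TensorProduct

/-! ### Finiteness and smoothness of rings of invariants -/

section Invariants

variable {k S E ι : Type u} [Field k] [CommRing S] [Algebra k S] [Group E] [Fintype E] [Fintype ι]
  {ρ : E →* (S →ₐ[k] S)} {a b : ι → S}

theorem finiteType_fixedSubalgebra [Algebra.FiniteType k S] (h : IsGaloisCoordinates ρ a b) :
    Algebra.FiniteType k (fixedSubalgebra ρ) := by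
  have := finite_of_isGaloisCoordinates h
  exact ⟨fg_of_fg_of_fg k (fixedSubalgebra ρ) S Algebra.FiniteType.out Module.Finite.fg_top
    Subtype.val_injective⟩

theorem smooth_fixedSubalgebra [Algebra.Smooth k S] (h : IsGaloisCoordinates ρ a b) :
    Algebra.Smooth k (fixedSubalgebra ρ) := by
  have := finiteType_fixedSubalgebra h
  have := finite_of_isGaloisCoordinates h
  have := projective_of_isGaloisCoordinates h
  have := faithfullyFlat_of_isGaloisCoordinates h
  have := formallyUnramified_of_isGaloisCoordinates h
  have : IsNoetherianRing (fixedSubalgebra ρ) := Algebra.FiniteType.isNoetherianRing k _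
  have : Algebra.FinitePresentation (fixedSubalgebra ρ) S :=
    Algebra.FinitePresentation.of_finiteType.1 inferInstance
  have : Algebra.FinitePresentation k (fixedSubalgebra ρ) :=
    Algebra.FinitePresentation.of_finiteType.1 inferInstance
  have : Algebra.Etale (fixedSubalgebra ρ) S := Algebra.Etale.of_formallyUnramified_of_flat
  exact smooth_of_etale_of_faithfullyFlat k (fixedSubalgebra ρ) S

end Invariants

/-! ### The coordinate ring of the general linear group -/

section GenericMatrix

variable (k E : Type u) [CommRing k] [Fintype E] [DecidableEq E]

/-- The coordinate ring of the general linear group of `E × E` matrices over `k`. -/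
def GenericGL : Type u :=
  Localization.Away (Matrix.det (Matrix.mvPolynomialX E E k))

namespace GenericGL

noncomputable instance : CommRing (GenericGL k E) :=
  inferInstanceAs (CommRing (Localization.Away (Matrix.det (Matrix.mvPolynomialX E E k))))

noncomputable instance {R : Type u} [CommRing R] [Algebra R k] : Algebra R (GenericGL k E) :=
  inferInstanceAs (Algebra R (Localization.Away (Matrix.det (Matrix.mvPolynomialX E E k))))

noncomputable instance : Algebra (MvPolynomial (E × E) k) (GenericGL k E) :=
  inferInstanceAs (Algebra _ (Localization.Away (Matrix.det (Matrix.mvPolynomialX E E k))))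

instance {R : Type u} [CommRing R] [Algebra R k] :
    IsScalarTower R (MvPolynomial (E × E) k) (GenericGL k E) :=
  inferInstanceAs (IsScalarTower R (MvPolynomial (E × E) k)
    (Localization.Away (Matrix.det (Matrix.mvPolynomialX E E k))))

instance {R : Type u} [CommRing R] [Algebra R k] : IsScalarTower R k (GenericGL k E) :=
  inferInstanceAs (IsScalarTower R k
    (Localization.Away (Matrix.det (Matrix.mvPolynomialX E E k))))

instance : IsLocalization.Away (Matrix.det (Matrix.mvPolynomialX E E k)) (GenericGL k E) :=
  inferInstanceAs (IsLocalization.Away _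
    (Localization.Away (Matrix.det (Matrix.mvPolynomialX E E k))))

/-- The generic invertible matrix. -/
noncomputable def X : Matrix E E (GenericGL k E) :=
  (Matrix.mvPolynomialX E E k).map (algebraMap _ _)

theorem isUnit_det_X : IsUnit (X k E).det := by
  have : (X k E).det = algebraMap _ (GenericGL k E) (Matrix.det (Matrix.mvPolynomialX E E k)) :=
    ((algebraMap (MvPolynomial (E × E) k) (GenericGL k E)).map_det _).symm
  rw [this]
  exact IsLocalization.Away.algebraMap_isUnit _

variable {k E} {B : Type u} [CommRing B] [Algebra k B]

/-- The homomorphism that sends the generic matrix to a given invertible matrix. -/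
noncomputable def lift (x : Matrix E E B) (hx : IsUnit x.det) : GenericGL k E →ₐ[k] B :=
  IsLocalization.liftAlgHom (M := Submonoid.powers (Matrix.det (Matrix.mvPolynomialX E E k)))
    (f := MvPolynomial.aeval fun p : E × E => x p.1 p.2) (by
      rintro ⟨_, n, rfl⟩
      have : MvPolynomial.aeval (fun p : E × E => x p.1 p.2) (Matrix.mvPolynomialX E E k).det
          = x.det := by
        rw [AlgHom.map_det]
        congr 1
        ext i j
        simp
      simp only [map_pow]
      rw [this]
      exact hx.pow n)

@[simp] theorem lift_X (x : Matrix E E B) (hx : IsUnit x.det) (e f : E) :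
    lift (k := k) x hx (X k E e f) = x e f := by
  simp [lift, X]

theorem hom_ext {φ ψ : GenericGL k E →ₐ[k] B} (h : ∀ e f, φ (X k E e f) = ψ (X k E e f)) :
    φ = ψ := by
  refine IsLocalization.algHom_ext (Submonoid.powers (Matrix.det (Matrix.mvPolynomialX E E k))) ?_
  refine MvPolynomial.algHom_ext fun p => ?_
  exact h p.1 p.2

instance : Algebra.FiniteType k (GenericGL k E) :=
  have : Algebra.FiniteType (MvPolynomial (E × E) k) (GenericGL k E) :=
    IsLocalization.finiteType_of_monoid_fg
      (Submonoid.powers (Matrix.det (Matrix.mvPolynomialX E E k))) _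
  .trans (S := MvPolynomial (E × E) k) inferInstance this

instance : Algebra.Smooth k (GenericGL k E) :=
  have : Algebra.Smooth (MvPolynomial (E × E) k) (GenericGL k E) :=
    .of_isLocalization_Away (Matrix.det (Matrix.mvPolynomialX E E k))
  have : Algebra.Smooth k (MvPolynomial (E × E) k) := ⟨inferInstance, inferInstance⟩
  .comp k (MvPolynomial (E × E) k) _

instance [IsDomain k] : IsDomain (GenericGL k E) :=
  IsLocalization.isDomain_localization
    (powers_le_nonZeroDivisors_of_noZeroDivisors (Matrix.det_mvPolynomialX_ne_zero E k))

theorem isUnit_det_map (φ : GenericGL k E →ₐ[k] B) :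
    IsUnit (Matrix.det (Matrix.of fun e f => φ (X k E e f))) := by
  have := (isUnit_det_X k E).map φ
  rwa [AlgHom.map_det] at this

/-- Base change to a field extension yields the coordinate ring over the larger field, which is a
domain. -/
theorem isDomain_tensorProduct (k E Ω : Type u) [Field k] [Fintype E] [DecidableEq E] [Field Ω]
    [Algebra k Ω] : IsDomain (Ω ⊗[k] GenericGL k E) := by
  let g : GenericGL k E →ₐ[k] Ω ⊗[k] GenericGL k E := Algebra.TensorProduct.includeRight
  let φ : Ω ⊗[k] GenericGL k E →ₐ[Ω] GenericGL Ω E :=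
    Algebra.TensorProduct.lift (Algebra.ofId Ω _) (lift (X Ω E) (isUnit_det_X Ω E))
      fun _ _ => .all _ _
  let ψ : GenericGL Ω E →ₐ[Ω] Ω ⊗[k] GenericGL k E := lift _ (isUnit_det_map g)
  have h : ψ.comp φ = AlgHom.id Ω _ := by
    refine Algebra.TensorProduct.ext
      (AlgHom.ext fun r => (AlgHom.commutes _ r).trans (AlgHom.commutes _ r).symm) (hom_ext fun e f => ?_)
    change ψ (φ (1 ⊗ₜ X k E e f)) = 1 ⊗ₜ X k E e f
    have : φ (1 ⊗ₜ X k E e f) = X Ω E e f := by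
      change algebraMap Ω (GenericGL Ω E) 1 * _ = _
      rw [map_one, one_mul]
      exact lift_X _ (isUnit_det_X Ω E) e f
    rw [this]
    exact lift_X _ _ e f
  have hφ : Function.Injective φ :=
    Function.LeftInverse.injective (g := ψ) fun y => DFunLike.congr_fun h y
  exact hφ.isDomain φ.toRingHom

end GenericGL

end GenericMatrix

/-! ### The action of a group over the Galois group -/

section Action

variable {k K E T : Type u} [Field k] [Field K] [Algebra k K] [Group E] [CommRing T] [Algebra k T]

/-- The diagonal action of `E` on `K ⊗ T`: through `p` on `K`, and through `τ` on `T`. -/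
noncomputable def diagonalAction (p : E →* Gal(K/k)) (τ : E →* (T →ₐ[k] T)) :
    E →* (K ⊗[k] T →ₐ[k] K ⊗[k] T) where
  toFun e := Algebra.TensorProduct.map (p e : K →ₐ[k] K) (τ e)
  map_one' := Algebra.TensorProduct.ext (by ext; simp) (by ext; simp)
  map_mul' a b := Algebra.TensorProduct.ext (by ext; simp) (by ext; simp)

@[simp] theorem diagonalAction_tmul (p : E →* Gal(K/k)) (τ : E →* (T →ₐ[k] T)) (e : E) (x : K)
    (y : T) : diagonalAction p τ e (x ⊗ₜ y) = p e x ⊗ₜ τ e y := rfl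

theorem IsGaloisCoordinates.diagonalAction {ι : Type u} [Fintype ι] {τ : E →* (T →ₐ[k] T)}
    {a b : ι → T} (h : IsGaloisCoordinates τ a b) (p : E →* Gal(K/k)) :
    IsGaloisCoordinates (diagonalAction p τ) (fun i => 1 ⊗ₜ a i) (fun i => 1 ⊗ₜ b i) := by
  refine ⟨?_, fun e he => ?_⟩
  · simp only [Algebra.TensorProduct.tmul_mul_tmul, one_mul, ← tmul_sum, h.sum_mul]
    rfl
  · simp only [diagonalAction_tmul, map_one, Algebra.TensorProduct.tmul_mul_tmul, one_mul,
      ← tmul_sum, h.sum_mul_of_ne e he, tmul_zero]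

/-- The multiplication map `K ⊗ (K ⊗ T)^E → K ⊗ T`. -/
noncomputable def quotientMul (p : E →* Gal(K/k)) (τ : E →* (T →ₐ[k] T)) :
    K ⊗[k] fixedSubalgebra (diagonalAction p τ) →ₐ[K] K ⊗[k] T :=
  Algebra.TensorProduct.lift (Algebra.ofId K _) (fixedSubalgebra (diagonalAction p τ)).val
    fun _ _ => .all _ _

theorem quotientMul_tmul (p : E →* Gal(K/k)) (τ : E →* (T →ₐ[k] T)) (x : K)
    (r : fixedSubalgebra (diagonalAction p τ)) :
    quotientMul p τ (x ⊗ₜ r) = (x ⊗ₜ 1) * (r : K ⊗[k] T) := rfl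

/-- Injectivity is Galois descent: the coefficients of an element of the kernel in a basis of `K`
are recovered by the dual basis for the trace form. -/
theorem quotientMul_injective [FiniteDimensional k K] [IsGalois k K] {p : E →* Gal(K/k)}
    (hp : Function.Surjective p) (τ : E →* (T →ₐ[k] T)) :
    Function.Injective (quotientMul p τ) := by
  classical
  rw [injective_iff_map_eq_zero]
  intro z hz
  let v := Module.finBasis k K
  let w := v.traceDual
  obtain ⟨r, rfl⟩ : ∃ r : Fin (Module.finrank k K) → fixedSubalgebra (diagonalAction p τ),
      z = ∑ i, v i ⊗ₜ r i := by
    refine TensorProduct.induction_on z ⟨0, by simp⟩ (fun x r => ⟨fun i => v.repr x i • r, ?_⟩) ?_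
    · conv_lhs => rw [← v.sum_repr x]
      simp only [sum_tmul, tmul_smul, smul_tmul']
    · rintro _ _ ⟨r, rfl⟩ ⟨r', rfl⟩
      exact ⟨r + r', by simp [tmul_add, Finset.sum_add_distrib]⟩
  have h1 : ∀ g : Gal(K/k), ∑ i, (g (v i) ⊗ₜ[k] (1 : T)) * (r i : K ⊗[k] T) = 0 := by
    intro g
    obtain ⟨e, rfl⟩ := hp g
    have := congrArg (diagonalAction p τ e) hz
    simp only [map_sum, quotientMul_tmul, map_mul, map_zero, diagonalAction_tmul, map_one] at this
    rw [← this]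
    exact Finset.sum_congr rfl fun i _ => by rw [(r i).2 e]
  have h2 : ∀ j, (r j : K ⊗[k] T) = 0 := by
    intro j
    have h3 : ∑ g : Gal(K/k), (g (w j) ⊗ₜ[k] (1 : T)) *
        ∑ i, (g (v i) ⊗ₜ[k] (1 : T)) * (r i : K ⊗[k] T) = 0 :=
      Finset.sum_eq_zero fun g _ => by rw [h1, mul_zero]
    simp only [Finset.mul_sum] at h3
    rw [Finset.sum_comm] at h3
    simp only [← mul_assoc, ← Finset.sum_mul, Algebra.TensorProduct.tmul_mul_tmul, one_mul,
      ← sum_tmul, ← map_mul, ← trace_eq_sum_automorphisms] at h3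
    rw [Finset.sum_eq_single j] at h3
    · rwa [v.trace_traceDual_mul, if_pos rfl, map_one, ← Algebra.TensorProduct.one_def,
        one_mul] at h3
    · intro i _ hi
      rw [v.trace_traceDual_mul, if_neg (by tauto), map_zero, zero_tmul, zero_mul]
    · simp
  refine Finset.sum_eq_zero fun i _ => ?_
  rw [show r i = 0 from Subtype.ext (h2 i), tmul_zero]

/-- A `k`-algebra is geometrically integral if it embeds in a geometrically integral one after an
algebraic extension `K / k`: every field extension of `k` is contained in one that contains `K`. -/
theorem isDomain_tensorProduct_of_injective {R : Type u} [CommRing R] [Algebra k R]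
    [Algebra.IsAlgebraic k K] (j : K ⊗[k] R →ₐ[K] K ⊗[k] T) (hj : Function.Injective j)
    (hT : ∀ (Ω : Type u) [Field Ω] [Algebra k Ω], IsDomain (Ω ⊗[k] T))
    (Ω : Type u) [Field Ω] [Algebra k Ω] : IsDomain (Ω ⊗[k] R) := by
  let Ω' := AlgebraicClosure Ω
  let i : K →ₐ[k] Ω' := IsAlgClosed.lift
  let _ : Algebra K Ω' := i.toAlgebra
  have : IsScalarTower k K Ω' := .of_algebraMap_eq fun x => (i.commutes x).symm
  have h1 : Function.Injective (Algebra.TensorProduct.map (IsScalarTower.toAlgHom k Ω Ω')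
      (AlgHom.id k R)) :=
    Module.Flat.rTensor_preserves_injective_linearMap (M := R)
      (IsScalarTower.toAlgHom k Ω Ω').toLinearMap (algebraMap Ω Ω').injective
  have h2 : Function.Injective (Algebra.TensorProduct.map (AlgHom.id K Ω') j) :=
    Module.Flat.lTensor_preserves_injective_linearMap (M := Ω') j.toLinearMap hj
  let e1 := Algebra.TensorProduct.cancelBaseChange k K K Ω' R
  let e2 := Algebra.TensorProduct.cancelBaseChange k K K Ω' T
  have := hT Ω'
  have h3 : Function.Injective ((e2.toRingEquiv.toRingHom.comp
      ((Algebra.TensorProduct.map (AlgHom.id K Ω') j).toRingHom.comp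
        e1.symm.toRingEquiv.toRingHom)).comp
      (Algebra.TensorProduct.map (IsScalarTower.toAlgHom k Ω Ω') (AlgHom.id k R)).toRingHom) :=
    (e2.injective.comp (h2.comp e1.symm.injective)).comp h1
  exact h3.isDomain _

end Action

section RowAction

variable {k E : Type u} [Field k] [Group E] [Fintype E] [DecidableEq E]

open GenericGL

variable (k E) in
/-- The action of a finite group on `GL_E` by permutation of the rows. -/
noncomputable def rowAction : E →* (GenericGL k E →ₐ[k] GenericGL k E) where
  toFun e := lift ((X k E).submatrix (Equiv.mulLeft e) id) (by
    rw [Matrix.det_permute]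
    exact ((Equiv.Perm.sign (Equiv.mulLeft e)).isUnit.map (Int.castRingHom _)).mul
      (isUnit_det_X k E))
  map_one' := hom_ext fun e f => by simp
  map_mul' a b := hom_ext fun e f => by simp [mul_assoc]

@[simp] theorem rowAction_X (a e f : E) : rowAction k E a (X k E e f) = X k E (a * e) f := by
  simp [rowAction]

variable (k E) in
/-- The first row of the generic matrix and the first column of its inverse are Galois
coordinates, since `e` moves the first row to the row `e`. -/
theorem isGaloisCoordinates_rowAction : IsGaloisCoordinates (rowAction k E)
    (fun f => (X k E)⁻¹ f 1) (fun f => X k E 1 f) := by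
  have key : ∀ e, ∑ f, (X k E)⁻¹ f 1 * rowAction k E e (X k E 1 f) =
      (1 : Matrix E E (GenericGL k E)) e 1 := by
    intro e
    rw [← Matrix.mul_nonsing_inv _ (isUnit_det_X k E), Matrix.mul_apply]
    exact Finset.sum_congr rfl fun f _ => by rw [rowAction_X, mul_one, mul_comm]
  refine ⟨?_, fun e he => ?_⟩
  · have := key 1
    rwa [map_one, Matrix.one_apply_eq] at this
  · rw [key, Matrix.one_apply_ne he]

end RowAction

end GaloisSplitting

namespace GaloisSplitting

open TensorProduct GenericGL

/-! ### Points of the quotient and lifts of Galois representations -/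

section Points

variable {k K E T l ls : Type u} [Field k] [Field K] [Algebra k K] [Group E] [CommRing T]
  [Algebra k T] {p : E →* Gal(K/k)} {τ : E →* (T →ₐ[k] T)}
  [Field l] [Field ls] [Algebra k l] [Algebra l ls] [Algebra k ls] [IsScalarTower k l ls]
  [Algebra K ls] [IsScalarTower k K ls]

/-- A homomorphism `Gal(ls / l) → E` with open kernel that lifts the action on `K`. -/
structure IsLift (p : E →* Gal(K/k)) (r : Gal(ls/l) →* E) : Prop where
  isOpen_ker : IsOpen (r.ker : Set Gal(ls/l))
  algebraMap_apply : ∀ γ x, algebraMap K ls (p (r γ) x) = γ (algebraMap K ls x)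

/-- Every point of the quotient over `l` lifts to a point `s` of the covering over `ls`, and
`γ ∘ s = s ∘ r(γ)` defines the homomorphism `r`. -/
theorem exists_isLift_of_algHom [Fintype E] [FiniteDimensional k K] [Normal k K]
    [IsSepClosure l ls] [Algebra.FiniteType k T]
    {ι : Type u} [Fintype ι] {a b : ι → T} (h : IsGaloisCoordinates τ a b)
    (hp : Function.Surjective p)
    (f : fixedSubalgebra (diagonalAction p τ) →ₐ[k] l) :
    ∃ r : Gal(ls/l) →* E, IsLift p r := by
  have := IsSepClosure.sep_closed l (K := ls)
  have := (IsSepClosure.separable (k := l) (K := ls)).isAlgebraic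
  have h' := h.diagonalAction p
  obtain ⟨s₀, hs₀⟩ := exists_extension_of_isGaloisCoordinates h' (ls := ls) (f : _ →+* l)
  -- The restriction of `s₀` to `K` may be any embedding over `k`; it is corrected by an element
  -- of `E`.
  let i₀ : K →ₐ[k] ls :=
    { toRingHom := s₀.comp (algebraMap K (K ⊗[k] T))
      commutes' := fun x => by
        have := hs₀ (algebraMap k _ x)
        rw [RingHom.coe_coe, f.commutes, ← IsScalarTower.algebraMap_apply] at this
        rw [← this]
        change s₀ (algebraMap K (K ⊗[k] T) (algebraMap k K x)) = s₀ (algebraMap k (K ⊗[k] T) x)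
        rw [← IsScalarTower.algebraMap_apply] }
  let g₀ : Gal(K/k) := AlgEquiv.ofBijective (i₀.restrictNormal K)
    (Algebra.IsAlgebraic.algHom_bijective _)
  obtain ⟨e₀, he₀⟩ := hp g₀⁻¹
  let s : K ⊗[k] T →+* ls := s₀.comp (diagonalAction p τ e₀ : K ⊗[k] T →+* K ⊗[k] T)
  have hs : ∀ y : fixedSubalgebra (diagonalAction p τ), s y = algebraMap l ls (f y) := fun y => by
    change s₀ (diagonalAction p τ e₀ y) = _
    rw [y.2 e₀]
    exact hs₀ y
  have hK : ∀ x : K, s (x ⊗ₜ 1) = algebraMap K ls x := fun x => by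
    change s₀ (diagonalAction p τ e₀ (x ⊗ₜ 1)) = _
    rw [diagonalAction_tmul, map_one, he₀]
    change i₀ (algebraMap K K (g₀⁻¹ x)) = _
    rw [← AlgHom.restrictNormal_commutes]
    change algebraMap K ls (g₀ (g₀⁻¹ x)) = _
    rw [← AlgEquiv.mul_apply, mul_inv_cancel, AlgEquiv.one_apply]
  have hex : ∀ γ : Gal(ls/l), ∃ e, ∀ y, γ (s y) = s (diagonalAction p τ e y) := fun γ =>
    exists_eq_comp_of_isGaloisCoordinates h' ((γ : ls →+* ls).comp s) s fun y => by
      rw [RingHom.comp_apply, hs]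
      exact γ.commutes _
  choose r hr using hex
  have huniq : ∀ e e', (∀ y, s (diagonalAction p τ e y) = s (diagonalAction p τ e' y)) → e = e' :=
    fun e e' => eq_of_comp_eq_of_isGaloisCoordinates h' s e e'
  let R : Gal(ls/l) →* E := .mk' r fun γ γ' => huniq _ _ fun y => by
    rw [← hr, map_mul, AlgHom.mul_apply, ← hr, ← hr]
    rfl
  refine ⟨R, ?_, fun γ x => ?_⟩
  · -- An automorphism that fixes the coordinates of `s` is in the kernel.
    have : Algebra.FiniteType k (K ⊗[k] T) := .trans (S := K) inferInstance inferInstance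
    obtain ⟨t, ht⟩ := Algebra.FiniteType.out (R := k) (A := K ⊗[k] T)
    let F : IntermediateField l ls := IntermediateField.adjoin l (s '' (t : Set (K ⊗[k] T)))
    have : Finite (s '' (t : Set (K ⊗[k] T))) := (t.finite_toSet.image _).to_subtype
    have : FiniteDimensional l F :=
      IntermediateField.finiteDimensional_adjoin fun x _ => Algebra.IsIntegral.isIntegral x
    refine Subgroup.isOpen_mono (H₁ := F.fixingSubgroup) (fun γ hγ => ?_) F.fixingSubgroup_isOpen
    refine huniq _ _ fun y => ?_
    rw [map_one, AlgHom.one_apply]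
    refine (hr γ y).symm.trans ?_
    have hy : y ∈ Algebra.adjoin k (t : Set (K ⊗[k] T)) := ht ▸ Algebra.mem_top
    induction hy using Algebra.adjoin_induction with
    | mem x hx =>
      exact (IntermediateField.mem_fixingSubgroup_iff F γ).1 hγ _
        (IntermediateField.subset_adjoin l _ ⟨x, hx, rfl⟩)
    | algebraMap x =>
      have := hs (algebraMap k _ x)
      change s (algebraMap k _ x) = _ at this
      rw [this]
      exact γ.commutes _
    | add x y _ _ hx hy => rw [map_add, map_add, hx, hy]
    | mul x y _ _ hx hy => rw [map_mul, map_mul, hx, hy]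
  · have := hr γ (x ⊗ₜ 1)
    rw [diagonalAction_tmul, map_one, hK, hK] at this
    exact this.symm

/-- An equivariant point of `T` over `ls` descends to a point of the quotient over `l`. -/
theorem nonempty_algHom_of_equivariant [IsGalois l ls] {r : Gal(ls/l) →* E} (hr : IsLift p r)
    (t : T →ₐ[k] ls) (ht : ∀ γ y, γ (t y) = t (τ (r γ) y)) :
    Nonempty (fixedSubalgebra (diagonalAction p τ) →ₐ[k] l) := by
  let s : K ⊗[k] T →ₐ[k] ls := Algebra.TensorProduct.productMap (IsScalarTower.toAlgHom k K ls) t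
  have hs : ∀ γ y, γ (s y) = s (diagonalAction p τ (r γ) y) := by
    intro γ y
    induction y using TensorProduct.induction_on with
    | zero => simp
    | add x y hx hy => rw [map_add, map_add, map_add, map_add, hx, hy]
    | tmul x y =>
      rw [diagonalAction_tmul, Algebra.TensorProduct.productMap_apply_tmul, map_mul, ht,
        Algebra.TensorProduct.productMap_apply_tmul]
      congr 1
      exact (hr.algebraMap_apply γ x).symm
  have hmem : ∀ y : fixedSubalgebra (diagonalAction p τ),
      s y ∈ (IsScalarTower.toAlgHom k l ls).range := by
    intro y
    have : s y ∈ (⊥ : IntermediateField l ls) := by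
      rw [InfiniteGalois.mem_bot_iff_fixed]
      intro γ
      rw [hs, y.2]
    exact this
  exact ⟨((AlgEquiv.ofInjective (IsScalarTower.toAlgHom k l ls)
    (algebraMap l ls).injective).symm : _ →ₐ[k] l).comp
    ((s.comp (Subalgebra.val _)).codRestrict _ hmem)⟩

end Points

section Hilbert

variable {l ls E : Type u} [Field l] [Field ls] [Algebra l ls] [IsGalois l ls] [Group E]
  [Fintype E] [DecidableEq E]

/-- The vanishing of `H¹` with values in `GL_E`, for the cocycle of permutation matrices of `r`.
The rows of the matrix are equivariant, and the equivariant functions span, by independence of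
characters. -/
theorem exists_equivariant_matrix (r : Gal(ls/l) →* E) (hr : IsOpen (r.ker : Set Gal(ls/l))) :
    ∃ x : Matrix E E ls, IsUnit x.det ∧ ∀ γ e f, γ (x e f) = x (r γ * e) f := by
  classical
  have := Fintype.ofFinite r.range
  let W : Set (E → ls) := {x | ∀ γ e, γ (x e) = x (r γ * e)}
  have hW : Submodule.span ls W = ⊤ := by
    by_contra hne
    obtain ⟨φ, hφ0, hφ⟩ := Submodule.exists_le_ker_of_lt_top _ (lt_top_iff_ne_top.2 hne)
    refine hφ0 (LinearMap.pi_ext' fun f => LinearMap.ext_ring ?_)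
    let H : ClosedSubgroup Gal(ls/l) := ⟨r.ker, r.ker.isClosed_of_isOpen hr⟩
    let L : IntermediateField l ls := IntermediateField.fixedField r.ker
    have hL : L.fixingSubgroup = r.ker := InfiniteGalois.fixingSubgroup_fixedField H
    -- `σ h` is a lift of `h`; its restriction to `L` depends only on `h`.
    choose σ hσ using fun h : r.range => h.2
    let c : r.range → (L →* ls) := fun h => ((σ h : ls →+* ls).comp (algebraMap L ls) : L →* ls)
    have hc : Function.Injective c := by
      intro h h' hh
      have : (σ h)⁻¹ * σ h' ∈ L.fixingSubgroup := by
        rw [IntermediateField.mem_fixingSubgroup_iff]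
        intro x hx
        rw [AlgEquiv.mul_apply, AlgEquiv.aut_inv, AlgEquiv.symm_apply_eq]
        exact (DFunLike.congr_fun hh ⟨x, hx⟩).symm
      rw [hL, MonoidHom.mem_ker, map_mul, map_inv, hσ, hσ, inv_mul_eq_one] at this
      exact Subtype.ext this
    have hli : LinearIndependent ls fun h => (c h : L → ls) :=
      (linearIndependent_monoidHom L ls).comp c hc
    have hz : ∀ z : L, ∑ h : r.range, φ (Pi.single (h * f) 1) * c h z = 0 := by
      intro z
      let x : E → ls := ∑ h : r.range, c h z • Pi.single (h * f) 1
      have hx : ∀ h : r.range, x (h * f) = c h z := fun h => by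
        have hxa : x (h * f) = ∑ h', (c h' z • Pi.single (h' * f) 1 : E → ls) (h * f) :=
          Finset.sum_apply _ _ _
        rw [hxa, Finset.sum_eq_single h]
        · simp
        · intro h' _ hne
          rw [Pi.smul_apply, Pi.single_eq_of_ne, smul_zero]
          exact fun hh => hne (Subtype.ext (mul_right_cancel hh).symm)
        · simp
      have hx' : ∀ e, e * f⁻¹ ∉ r.range → x e = 0 := fun e he => by
        refine (Finset.sum_apply _ _ _).trans (Finset.sum_eq_zero fun h _ => ?_)
        rw [Pi.smul_apply, Pi.single_eq_of_ne, smul_zero]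
        rintro rfl
        exact he (by simp)
      have hxW : x ∈ W := by
        intro γ e
        by_cases he : e * f⁻¹ ∈ r.range
        · obtain ⟨h, rfl⟩ : ∃ h : r.range, e = h * f := ⟨⟨_, he⟩, by simp⟩
          have h2 : r γ * (h * f) = ((⟨r γ, γ, rfl⟩ * h : r.range) : E) * f := by
            rw [← mul_assoc]; rfl
          rw [h2, hx, hx]
          have : (σ (⟨r γ, γ, rfl⟩ * h))⁻¹ * (γ * σ h) ∈ L.fixingSubgroup := by
            rw [hL, MonoidHom.mem_ker, map_mul, map_mul, map_inv, hσ, hσ, inv_mul_eq_one]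
            rfl
          have := (IntermediateField.mem_fixingSubgroup_iff _ _).1 this z z.2
          rw [AlgEquiv.mul_apply, AlgEquiv.aut_inv, AlgEquiv.symm_apply_eq] at this
          exact this
        · rw [hx' e he, map_zero, hx']
          intro h2
          rw [mul_assoc] at h2
          exact he (by simpa using r.range.mul_mem (r.range.inv_mem ⟨γ, rfl⟩) h2)
      have := hφ (Submodule.subset_span hxW)
      rw [LinearMap.mem_ker, map_sum] at this
      rw [← this]
      exact Finset.sum_congr rfl fun h _ => by rw [map_smul, smul_eq_mul, mul_comm]
    have := Fintype.linearIndependent_iff.1 hli (fun h => φ (Pi.single (h * f) 1))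
      (funext fun z => by simpa [Finset.sum_apply] using hz z) 1
    simpa using this
  obtain ⟨B, hBW, hBs, hBi⟩ := exists_linearIndependent ls W
  let b : Module.Basis B ls (E → ls) := .mk hBi (by rw [Subtype.range_coe, hBs, hW])
  have hcard : Fintype.card E = Nat.card B := by
    rw [← Module.finrank_eq_nat_card_basis b, Module.finrank_fintype_fun_eq_card]
  have : Finite B := Module.Finite.finite_basis b
  obtain ⟨ε⟩ : Nonempty (E ≃ B) := Finite.card_eq.1 (by rw [Nat.card_eq_fintype_card, hcard])
  refine ⟨Matrix.of fun e f => (ε f : E → ls) e, ?_, fun γ e f => hBW (ε f).2 γ e⟩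
  rw [← Matrix.isUnit_iff_isUnit_det, ← Matrix.linearIndependent_cols_iff_isUnit]
  exact hBi.comp ε ε.injective

end Hilbert

section Quotient

variable {k K E : Type u} [Field k] [Field K] [Algebra k K] [Group E] [Fintype E] [DecidableEq E]

/-- The coordinate ring of the variety attached to a homomorphism `p : E → Gal(K / k)`, the quotient
of `GL_E` over `K` by the diagonal action of `E`. It is a form of the quotient of `GL_E` by
`ker p`. -/
def QuotientRing (p : E →* Gal(K/k)) : Type u := fixedSubalgebra (diagonalAction p (rowAction k E))

namespace QuotientRing

noncomputable instance (p : E →* Gal(K/k)) : CommRing (QuotientRing p) :=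
  inferInstanceAs (CommRing (fixedSubalgebra (diagonalAction p (rowAction k E))))

noncomputable instance (p : E →* Gal(K/k)) : Algebra k (QuotientRing p) :=
  inferInstanceAs (Algebra k (fixedSubalgebra (diagonalAction p (rowAction k E))))

theorem smooth [FiniteDimensional k K] [IsGalois k K] (p : E →* Gal(K/k)) :
    Algebra.Smooth k (QuotientRing p) := by
  have : Algebra.FormallyEtale k K := .of_isSeparable k K
  have : Algebra.Smooth k K := ⟨inferInstance,
    Algebra.FinitePresentation.of_finiteType.1 inferInstance⟩
  have : Algebra.Smooth k (K ⊗[k] GenericGL k E) := .comp k K _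
  exact smooth_fixedSubalgebra ((isGaloisCoordinates_rowAction k E).diagonalAction p)

theorem isDomain_tensorProduct [FiniteDimensional k K] [IsGalois k K] {p : E →* Gal(K/k)}
    (hp : Function.Surjective p) (Ω : Type u) [Field Ω] [Algebra k Ω] :
    IsDomain (Ω ⊗[k] QuotientRing p) :=
  isDomain_tensorProduct_of_injective (quotientMul p (rowAction k E)) (quotientMul_injective hp _)
    (fun Ω _ _ => GenericGL.isDomain_tensorProduct k E Ω) Ω

/-- The points of the quotient over `l` exist exactly when the Galois representation of `l` on `K`
lifts to `E`. -/
theorem nonempty_algHom_iff [FiniteDimensional k K] [IsGalois k K] {p : E →* Gal(K/k)}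
    (hp : Function.Surjective p) {l ls : Type u} [Field l] [Field ls] [Algebra k l] [Algebra l ls]
    [IsSepClosure l ls] [Algebra k ls] [IsScalarTower k l ls] [Algebra K ls]
    [IsScalarTower k K ls] :
    Nonempty (QuotientRing p →ₐ[k] l) ↔ ∃ r : Gal(ls/l) →* E, IsLift p r := by
  refine ⟨fun ⟨f⟩ => exists_isLift_of_algHom (isGaloisCoordinates_rowAction k E) hp f, ?_⟩
  rintro ⟨r, hr⟩
  have : IsGalois l ls := inferInstance
  obtain ⟨x, hx, hγ⟩ := exists_equivariant_matrix r hr.isOpen_ker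
  refine nonempty_algHom_of_equivariant hr (GenericGL.lift x hx) fun γ y => ?_
  let γ' : ls →ₐ[k] ls := γ.restrictScalars k
  have : γ'.comp (GenericGL.lift x hx) = (GenericGL.lift x hx).comp (rowAction k E (r γ)) :=
    hom_ext fun e f => by simp; exact hγ γ e f
  exact DFunLike.congr_fun this y

end QuotientRing

end Quotient

end GaloisSplitting

namespace GaloisSplitting

open TensorProduct GenericGL

/-! ### Functoriality of the quotients -/

section BlockDiagonal

/-- A group is a disjoint union of copies of a subgroup, compatibly with left translations. -/
theorem exists_equiv_prod_of_injective {E E' : Type u} [Group E] [Group E'] [Finite E']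
    (j : E →* E') (hj : Function.Injective j) :
    ∃ (J : Type u) (_ : Finite J) (ε : E' ≃ E × J),
      ∀ e a, ε (j e * a) = (e * (ε a).1, (ε a).2) := by
  let J := Quotient (QuotientGroup.rightRel j.range)
  have h1 : ∀ a : E', ∃ e, j e * (Quotient.mk (QuotientGroup.rightRel j.range) a).out = a := by
    intro a
    have : QuotientGroup.rightRel j.range (Quotient.mk _ a).out a := Quotient.mk_out a
    rw [QuotientGroup.rightRel_apply] at this
    obtain ⟨e, he⟩ := this
    exact ⟨e, by rw [he]; group⟩
  choose c hc using h1
  have h2 : ∀ e (a : E'), Quotient.mk (QuotientGroup.rightRel j.range) (j e * a) = Quotient.mk _ a :=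
    fun e a => Quotient.sound (QuotientGroup.rightRel_apply.2 ⟨e⁻¹, by simp⟩)
  have h3 : ∀ e a, c (j e * a) = e * c a := fun e a => hj (by
    have := hc (j e * a)
    rw [h2] at this
    rw [← mul_left_inj (Quotient.mk (QuotientGroup.rightRel j.range) a).out, this, map_mul,
      mul_assoc, hc])
  refine ⟨J, inferInstance, ⟨fun a => (c a, Quotient.mk _ a), fun x => j x.1 * x.2.out, hc,
    fun x => ?_⟩, fun e a => Prod.ext (h3 e a) (h2 e a)⟩
  refine Prod.ext (hj ?_) ((h2 _ _).trans (Quotient.out_eq _))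
  have := hc (j x.1 * x.2.out)
  rw [h2, Quotient.out_eq] at this
  exact mul_right_cancel this

variable {k K E E' : Type u} [Field k] [Field K] [Algebra k K] [Group E] [Fintype E]
  [DecidableEq E] [Group E'] [Fintype E'] [DecidableEq E']

/-- The homomorphism is the block diagonal embedding of `GL_E` in `GL_E'`. -/
theorem exists_equivariant_algHom (j : E →* E') (hj : Function.Injective j) :
    ∃ φ : GenericGL k E' →ₐ[k] GenericGL k E,
      ∀ e y, φ (rowAction k E' (j e) y) = rowAction k E e (φ y) := by
  classical
  obtain ⟨J, _, ε, hε⟩ := exists_equiv_prod_of_injective j hj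
  have := Fintype.ofFinite J
  let D : Matrix (E × J) (E × J) (GenericGL k E) := Matrix.blockDiagonal fun _ => X k E
  have hD : IsUnit D.det := by
    rw [Matrix.det_blockDiagonal]
    exact Finset.prod_induction _ IsUnit (fun _ _ => IsUnit.mul) isUnit_one
      fun _ _ => isUnit_det_X k E
  let y : Matrix E' E' (GenericGL k E) := D.submatrix ε ε
  have hy : IsUnit y.det := by rwa [Matrix.det_submatrix_equiv_self]
  refine ⟨GenericGL.lift y hy, fun e z => ?_⟩
  have : (GenericGL.lift y hy).comp (rowAction k E' (j e)) =
      (rowAction k E e).comp (GenericGL.lift y hy) := by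
    refine hom_ext fun a b => ?_
    rw [AlgHom.comp_apply, AlgHom.comp_apply, rowAction_X, lift_X, lift_X]
    simp only [y, D, Matrix.submatrix_apply, hε, Matrix.blockDiagonal_apply]
    split_ifs
    · rw [rowAction_X]
    · rw [map_zero]
  exact DFunLike.congr_fun this z

theorem QuotientRing.nonempty_algHom {p : E →* Gal(K/k)} {p' : E' →* Gal(K/k)} (j : E →* E')
    (hj : Function.Injective j) (hp : p'.comp j = p) :
    Nonempty (QuotientRing p' →ₐ[k] QuotientRing p) := by
  obtain ⟨φ, hφ⟩ := exists_equivariant_algHom (k := k) j hj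
  let ψ : K ⊗[k] GenericGL k E' →ₐ[k] K ⊗[k] GenericGL k E :=
    Algebra.TensorProduct.map (AlgHom.id k K) φ
  have hψ : ∀ e y, ψ (diagonalAction p' (rowAction k E') (j e) y) =
      diagonalAction p (rowAction k E) e (ψ y) := by
    intro e y
    induction y using TensorProduct.induction_on with
    | zero => simp
    | add x y hx hy => simp only [map_add, hx, hy]
    | tmul x y =>
      change p' (j e) x ⊗ₜ[k] φ (rowAction k E' (j e) y) = p e x ⊗ₜ[k] rowAction k E e (φ y)
      rw [hφ, ← hp]
      rfl
  exact ⟨(ψ.comp (fixedSubalgebra (diagonalAction p' (rowAction k E'))).val).codRestrict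
    (fixedSubalgebra (diagonalAction p (rowAction k E))) fun y e => by
      change diagonalAction p (rowAction k E) e (ψ y) = ψ y
      rw [← hψ, y.2 (j e)]⟩

end BlockDiagonal

/-! ### Making the transition maps surjective -/

section PolynomialTower

variable {k : Type u} [Field k] {R : Type u} [CommRing R] [Algebra k R] {N : ℕ}

theorem smooth_mvPolynomial [Algebra.Smooth k R] : Algebra.Smooth k (MvPolynomial (Fin N) R) :=
  have : Algebra.Smooth R (MvPolynomial (Fin N) R) := ⟨inferInstance, inferInstance⟩
  .comp k R _

theorem isDomain_tensorProduct_mvPolynomial (Ω : Type u) [Field Ω] [Algebra k Ω]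
    [IsDomain (Ω ⊗[k] R)] : IsDomain (Ω ⊗[k] MvPolynomial (Fin N) R) :=
  (MvPolynomial.rTensorAlgEquiv (R := k) (S := Ω) (N := R) (σ := Fin N)).injective.isDomain
    (MvPolynomial.rTensorAlgEquiv (R := k) (S := Ω) (N := R) (σ := Fin N)).toRingEquiv.toRingHom

theorem nonempty_algHom_mvPolynomial_iff {l : Type u} [CommRing l] [Algebra k l] :
    Nonempty (MvPolynomial (Fin N) R →ₐ[k] l) ↔ Nonempty (R →ₐ[k] l) := by
  refine ⟨fun ⟨f⟩ => ⟨f.comp (IsScalarTower.toAlgHom k R _)⟩, fun ⟨f⟩ => ⟨f.comp ?_⟩⟩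
  exact (MvPolynomial.aeval (R := R) fun _ => (0 : R)).restrictScalars k

/-- After adding enough variables, a sequence of homomorphisms between finitely generated algebras
becomes a sequence of surjections: the new variables map to generators. -/
theorem exists_surjective_tower (R : ℕ → Type u) [∀ i, CommRing (R i)] [∀ i, Algebra k (R i)]
    [∀ i, Algebra.FiniteType k (R i)] (f : ∀ i, R (i + 1) →ₐ[k] R i) :
    ∃ N : ℕ → ℕ, ∀ i, ∃ g : MvPolynomial (Fin (N (i + 1))) (R (i + 1)) →ₐ[k]
      MvPolynomial (Fin (N i)) (R i), Function.Surjective g := by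
  have key : ∀ i N : ℕ, ∃ N' : ℕ, ∃ g : MvPolynomial (Fin N') (R (i + 1)) →ₐ[k]
      MvPolynomial (Fin N) (R i), Function.Surjective g := by
    intro i N
    have : Algebra.FiniteType k (MvPolynomial (Fin N) (R i)) :=
      .trans (S := R i) inferInstance inferInstance
    obtain ⟨N', h, hh⟩ := Algebra.FiniteType.iff_quotient_mvPolynomial''.1 this
    let φ : R (i + 1) →ₐ[k] MvPolynomial (Fin N) (R i) :=
      (IsScalarTower.toAlgHom k (R i) _).comp (f i)
    let _ : Algebra (R (i + 1)) (MvPolynomial (Fin N) (R i)) := φ.toAlgebra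
    have : IsScalarTower k (R (i + 1)) (MvPolynomial (Fin N) (R i)) :=
      .of_algebraMap_eq fun x => (φ.commutes x).symm
    let g : MvPolynomial (Fin N') (R (i + 1)) →ₐ[k] MvPolynomial (Fin N) (R i) :=
      (MvPolynomial.aeval (R := R (i + 1)) fun a => h (MvPolynomial.X a)).restrictScalars k
    refine ⟨N', g, fun b => ?_⟩
    obtain ⟨a, rfl⟩ := hh b
    refine ⟨MvPolynomial.map (algebraMap k (R (i + 1))) a, ?_⟩
    change MvPolynomial.aeval (R := R (i + 1)) _ _ = _
    rw [MvPolynomial.aeval_map_algebraMap]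
    exact (DFunLike.congr_fun (MvPolynomial.aeval_unique h) a).symm
  choose M hM using key
  exact ⟨fun i => i.rec 0 M, fun i => hM i _⟩

end PolynomialTower

end GaloisSplitting

namespace GaloisSplitting

open TensorProduct

/-! ### Affine varieties -/

section Affine

variable {k : Type u} [Field k]

variable (k) in
/-- The spectrum of a `k`-algebra, as a `k`-scheme. -/
noncomputable def specOver (B : Type u) [CommRing B] [Algebra k B] : Over (Spec (CommRingCat.of k)) :=
  Over.mk (Spec.map (CommRingCat.ofHom (algebraMap k B)))

variable {B C : Type u} [CommRing B] [Algebra k B] [CommRing C] [Algebra k C]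

/-- The morphism of spectra of a homomorphism of `k`-algebras. -/
noncomputable def specOverMap (f : B →ₐ[k] C) : specOver k C ⟶ specOver k B :=
  Over.homMk (Spec.map (CommRingCat.ofHom f.toRingHom)) (by
    change Spec.map _ ≫ Spec.map _ = Spec.map _
    rw [← Spec.map_comp, ← CommRingCat.ofHom_comp]
    congr 2
    exact f.comp_algebraMap)

theorem isClosedImmersion_specOverMap (f : B →ₐ[k] C) (hf : Function.Surjective f) :
    IsClosedImmersion (specOverMap f).left :=
  IsClosedImmersion.spec_of_surjective (CommRingCat.ofHom f.toRingHom) hf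

theorem hasPoint_specOver_iff {l : Type u} [Field l] [Algebra k l] :
    HasPoint (specOver k B) l ↔ Nonempty (B →ₐ[k] l) := by
  refine ⟨fun ⟨x⟩ => ?_, fun ⟨f⟩ => ⟨specOverMap f⟩⟩
  let y : Spec (CommRingCat.of l) ⟶ Spec (CommRingCat.of B) := x.left
  have hy : y ≫ Spec.map (CommRingCat.ofHom (algebraMap k B)) =
      Spec.map (CommRingCat.ofHom (algebraMap k l)) := Over.w x
  obtain ⟨φ, hφ⟩ := Spec.map_surjective y
  rw [← hφ, ← Spec.map_comp] at hy
  have := Spec.map_injective hy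
  exact ⟨{ φ.hom with commutes' := fun r => congr($(congrArg CommRingCat.Hom.hom this) r) }⟩

theorem isSmoothGeomIntegralVariety_specOver [Algebra.Smooth k B]
    (hB : ∀ (Ω : Type u) [Field Ω] [Algebra k Ω], IsDomain (Ω ⊗[k] B)) :
    IsSmoothGeomIntegralVariety (specOver k B) where
  separated := inferInstanceAs (IsSeparated (Spec.map _))
  quasiCompact := inferInstanceAs (QuasiCompact (Spec.map _))
  smooth := by
    change Smooth (Spec.map (CommRingCat.ofHom (algebraMap k B)))
    rw [HasRingHomProperty.Spec_iff (P := @Smooth)]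
    exact RingHom.smooth_algebraMap.2 inferInstance
  locallyOfFiniteType := by
    change LocallyOfFiniteType (Spec.map (CommRingCat.ofHom (algebraMap k B)))
    rw [HasRingHomProperty.Spec_iff (P := @LocallyOfFiniteType)]
    exact RingHom.finiteType_algebraMap.2 inferInstance
  geometricallyIntegral := by
    refine ⟨geometrically_iff_of_commRing.2 fun Ω _ _ Y fst snd h => ?_⟩
    have := hB Ω
    have : IsDomain (B ⊗[k] Ω) :=
      (Algebra.TensorProduct.comm k B Ω).toMulEquiv.isDomain _
    have : IsIntegral (Spec (CommRingCat.of (B ⊗[k] Ω))) := inferInstance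
    let e : Y ≅ Spec (CommRingCat.of (B ⊗[k] Ω)) := h.isoPullback ≪≫ pullbackSpecIso k B Ω
    have : Nonempty Y := ⟨e.hom.homeomorph.symm
      (Nonempty.some inferInstance)⟩
    exact isIntegral_of_isOpenImmersion e.hom

/-- A sequence of smooth algebras, integral after every extension of the base field, yields an
ind-variety with the same points. -/
theorem exists_indVariety (R : ℕ → Type u) [∀ i, CommRing (R i)] [∀ i, Algebra k (R i)]
    [∀ i, Algebra.Smooth k (R i)]
    (hR : ∀ i (Ω : Type u) [Field Ω] [Algebra k Ω], IsDomain (Ω ⊗[k] R i))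
    (f : ∀ i, Nonempty (R (i + 1) →ₐ[k] R i)) :
    ∃ X : SmoothGeomIntegralIndVariety k, ∀ (i : ℕ) (l : Type u) [Field l] [Algebra k l],
      HasPoint (X.X i) l ↔ Nonempty (R i →ₐ[k] l) := by
  obtain ⟨N, hN⟩ := exists_surjective_tower R fun i => (f i).some
  choose g hg using hN
  have hs (i : ℕ) : Algebra.Smooth k (MvPolynomial (Fin (N i)) (R i)) := smooth_mvPolynomial
  refine ⟨⟨fun i => specOver k (MvPolynomial (Fin (N i)) (R i)), fun i => ?_,
    fun i => specOverMap (g i), fun i => isClosedImmersion_specOverMap (g i) (hg i)⟩,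
    fun i l _ _ => hasPoint_specOver_iff.trans nonempty_algHom_mvPolynomial_iff⟩
  refine isSmoothGeomIntegralVariety_specOver fun Ω _ _ => ?_
  have := hR i Ω
  exact isDomain_tensorProduct_mvPolynomial Ω

end Affine

end GaloisSplitting

namespace GaloisSplitting

open TopRep NestedFun

/-! ### Continuous cochains as nested functions -/

/-- A continuous function from a compact space to a discrete space takes finitely many values, each
on a compact set. -/
theorem discreteTopology_continuousMap (X Y : Type u) [TopologicalSpace X] [CompactSpace X]
    [TopologicalSpace Y] [DiscreteTopology Y] : DiscreteTopology C(X, Y) := by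
  refine discreteTopology_iff_isOpen_singleton.2 fun f => ?_
  have hfin : (Set.range f).Finite := (isCompact_range f.continuous).finite_of_discrete
  have : ({f} : Set C(X, Y)) = ⋂ y ∈ Set.range f, {g : C(X, Y) | Set.MapsTo g (f ⁻¹' {y}) {y}} := by
    ext g
    simp only [Set.mem_singleton_iff, Set.mem_iInter, Set.mem_ofPred_eq]
    refine ⟨?_, fun h => ContinuousMap.ext fun x => h (f x) ⟨x, rfl⟩ rfl⟩
    rintro rfl y - x hx
    exact hx
  rw [this]
  exact hfin.isOpen_biInter fun y _ => ContinuousMap.isOpen_setOfPred_mapsTo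
    ((isClosed_discrete {y}).preimage f.continuous).isCompact (isOpen_discrete {y})

section Cochains

variable {Γ : Type u} [Group Γ] [TopologicalSpace Γ] [IsTopologicalGroup Γ] (X : TopRep.{u} ℤ Γ)

/-- The function underlying a continuous cochain. The invariant elements of `resolutionX X (n + 1)` are
the homogeneous cochains of degree `n`. -/
def toNested : ∀ n, (resolutionX X n).V →+ NestedFun Γ X.V n
  | 0 => AddMonoidHom.id X.V
  | n + 1 =>
    { toFun := fun (f : C(Γ, (resolutionX X n).V)) x => toNested n (f x)
      map_zero' := funext fun _ => map_zero (toNested n)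
      map_add' := fun _ _ => funext fun _ => map_add (toNested n) _ _ }

theorem toNested_succ_apply {n : ℕ} (f : C(Γ, (resolutionX X n).V)) (x : Γ) :
    toNested X (n + 1) f x = toNested X n (f x) := rfl

theorem toNested_injective : ∀ n, Function.Injective (toNested X n)
  | 0 => fun _ _ h => h
  | n + 1 => fun _ _ h => ContinuousMap.ext fun x => toNested_injective n (congrFun h x)

theorem toNested_d : ∀ {n : ℕ} (f : (resolutionX X n).V),
    toNested X (n + 1) ((d X n).hom f) = diff Γ X.V n (toNested X n f)
  | 0, _ => rfl
  | n + 1, f => by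
    funext x
    rw [diff_succ_apply, toNested_succ_apply]
    change toNested X (n + 1) (f - (d X n).hom ((f : C(Γ, (resolutionX X n).V)) x)) = _
    rw [map_sub, toNested_d]
    rfl

/-- The action of the group on the coefficients. -/
def coeffHom : Γ →* AddMonoid.End X.V where
  toFun γ :=
    { toFun := fun a => X.ρ γ a
      map_zero' := map_zero (X.ρ γ)
      map_add' := map_add (X.ρ γ) }
  map_one' := by ext a; exact congr($(map_one X.ρ) a)
  map_mul' g h := by ext a; exact congr($(map_mul X.ρ g h) a)

theorem toNested_ρ (γ : Γ) : ∀ {n : ℕ} (f : (resolutionX X n).V),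
    toNested X n ((resolutionX X n).ρ γ f) = act (coeffHom X) γ n (toNested X n f)
  | 0, _ => rfl
  | n + 1, f => funext fun x => toNested_ρ γ ((f : C(Γ, (resolutionX X n).V)) (γ⁻¹ * x))

theorem toNested_resolutionMap {Γ' : Type u} [Group Γ'] [TopologicalSpace Γ']
    [IsTopologicalGroup Γ'] (φ : Γ' →ₜ* Γ) : ∀ {n : ℕ} (f : (resolutionX X n).V),
    toNested (TopRep.res (φ : Γ' →* Γ) X) n
      ((ContinuousCohomology.resolutionMap φ (𝟙 (TopRep.res (φ : Γ' →* Γ) X)) n).hom f) =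
        pull X.V φ n (toNested X n f)
  | 0, _ => rfl
  | n + 1, f => funext fun x => toNested_resolutionMap φ ((f : C(Γ, (resolutionX X n).V)) (φ x))

/-- The continuous cochain attached to a cochain on a discrete quotient. -/
def ofNested {Q : Type u} {q : Γ → Q} (hq : IsLocallyConstant q) :
    ∀ n, NestedFun Q X.V n → (resolutionX X n).V
  | 0, a => a
  | _ + 1, c => (⟨fun x => ofNested hq _ (c (q x)),
      (hq.comp fun y => ofNested hq _ (c y)).continuous⟩ : C(Γ, _))

theorem toNested_ofNested {Q : Type u} {q : Γ → Q} (hq : IsLocallyConstant q) :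
    ∀ {n : ℕ} (c : NestedFun Q X.V n), toNested X n (ofNested X hq n c) = pull X.V q n c
  | 0, _ => rfl
  | _ + 1, c => funext fun x => toNested_ofNested hq (c (q x))

variable [CompactSpace Γ] [DiscreteTopology X.V]

theorem discreteTopology_resolutionX : ∀ n, DiscreteTopology (resolutionX X n).V
  | 0 => inferInstanceAs (DiscreteTopology X.V)
  | n + 1 =>
    have := discreteTopology_resolutionX n
    discreteTopology_continuousMap Γ (resolutionX X n).V

/-- A continuous function on a compact group with discrete values is uniformly locally constant. -/
theorem exists_open_nhds_forall_mul {Y : Type u} [TopologicalSpace Y] [DiscreteTopology Y]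
    (f : C(Γ, Y)) : ∃ U ∈ nhds (1 : Γ), ∀ γ, ∀ u ∈ U, f (γ * u) = f γ := by
  have h : ∀ γ : Γ, ∃ V ∈ nhds (1 : Γ), ∀ a ∈ V, ∀ b ∈ V, f (γ * (a * b)) = f γ := by
    intro γ
    have hc : ContinuousAt (fun p : Γ × Γ => f (γ * (p.1 * p.2))) (1, 1) := by fun_prop
    have : {p : Γ × Γ | f (γ * (p.1 * p.2)) = f γ} ∈ nhds ((1 : Γ), (1 : Γ)) :=
      hc.preimage_mem_nhds ((isOpen_discrete {f γ}).mem_nhds (by simp))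
    rw [nhds_prod_eq] at this
    obtain ⟨V, hV, hVV⟩ := Filter.mem_prod_same_iff.1 this
    exact ⟨V, hV, fun a ha b hb => hVV (Set.mk_mem_prod ha hb)⟩
  choose V hV hf using h
  obtain ⟨t, ht⟩ := CompactSpace.elim_nhds_subcover (fun γ => (fun a => γ * a) '' V γ)
    fun γ => by
      have := (Homeomorph.mulLeft γ).isOpenMap.image_mem_nhds (hV γ)
      simpa using this
  refine ⟨⋂ γ ∈ t, V γ, (Filter.biInter_finset_mem t).2 fun γ _ => hV γ, fun γ u hu => ?_⟩
  obtain ⟨γ₀, hγ₀, a, ha, rfl⟩ : ∃ γ₀ ∈ t, ∃ a ∈ V γ₀, γ₀ * a = γ := by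
    have : γ ∈ ⋃ x ∈ t, (fun a => x * a) '' V x := by rw [ht]; trivial
    simpa only [Set.mem_iUnion, exists_prop, Set.mem_image] using this
  have h1 := hf γ₀ a ha u (Set.mem_iInter₂.1 hu γ₀ hγ₀)
  have h2 := hf γ₀ a ha 1 (mem_of_mem_nhds (hV γ₀))
  simp only [mul_one] at h2
  rw [mul_assoc, h1, h2]

/-- Every continuous cochain is inflated from any sufficiently fine quotient. -/
theorem exists_nhds_forall_exists_pull_eq : ∀ {n : ℕ} (f : (resolutionX X n).V),
    ∃ U ∈ nhds (1 : Γ), ∀ (Q : Type u) [Group Q] (q : Γ →* Q), (q.ker : Set Γ) ⊆ U →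
      ∃ c : NestedFun Q X.V n, toNested X n f = pull X.V q n c
  | 0, f => ⟨Set.univ, Filter.univ_mem, fun _ _ _ _ => ⟨f, rfl⟩⟩
  | n + 1, f => by
    have := discreteTopology_resolutionX X n
    let F : C(Γ, (resolutionX X n).V) := f
    obtain ⟨U₀, hU₀, hF⟩ := exists_open_nhds_forall_mul F
    choose U hU h using fun v : (resolutionX X n).V => exists_nhds_forall_exists_pull_eq v
    have hfin : (Set.range F).Finite := (isCompact_range F.continuous).finite_of_discrete
    refine ⟨U₀ ∩ ⋂ v ∈ Set.range F, U v,
      Filter.inter_mem hU₀ ((Filter.biInter_mem hfin).2 fun v _ => hU v), fun Q _ q hq => ?_⟩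
    have hc : ∀ γ, ∃ c : NestedFun Q X.V n, toNested X n (F γ) = pull X.V q n c := fun γ =>
      h (F γ) Q q fun x hx => Set.mem_iInter₂.1 (hq hx).2 _ ⟨γ, rfl⟩
    choose c hc using hc
    classical
    refine ⟨fun x => if hx : ∃ γ, q γ = x then c hx.choose else 0, funext fun γ => ?_⟩
    have hx : ∃ γ', q γ' = q γ := ⟨γ, rfl⟩
    change toNested X n (F γ) = pull X.V q n (if hx : ∃ γ', q γ' = q γ then c hx.choose else 0)
    rw [dif_pos hx, ← hc]
    refine congrArg (toNested X n) ?_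
    have : F (hx.choose * (hx.choose⁻¹ * γ)) = F hx.choose := hF _ _ (hq (by
      rw [SetLike.mem_coe, MonoidHom.mem_ker, map_mul, map_inv, hx.choose_spec,
        inv_mul_cancel])).1
    rw [mul_inv_cancel_left] at this
    exact this

end Cochains

end GaloisSplitting

namespace GaloisSplitting

/-! ### Vanishing of cohomology classes -/

section Homology

variable {R : Type} [Ring R] [TopologicalSpace R]

/-- The presentation of the homology of topological modules as kernel modulo image. -/
noncomputable def leftHomologyData (S : ShortComplex (TopModuleCat.{u} R)) : S.LeftHomologyData :=
  ⟨_, _, _, _, _, TopModuleCat.isLimitKer _, by simp, TopModuleCat.isColimitCoker _⟩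

theorem exists_homologyπ_eq (S : ShortComplex (TopModuleCat.{u} R)) (α : S.homology) :
    ∃ x : S.cycles, S.homologyπ x = α := by
  let D := leftHomologyData S
  obtain ⟨y, hy⟩ := TopModuleCat.cokerπ_surjective _ (D.homologyIso.hom α)
  let y : D.K := y
  refine ⟨D.cyclesIso.inv y, ?_⟩
  have h1 := ConcreteCategory.congr_hom D.π_comp_homologyIso_inv y
  have h2 := ConcreteCategory.congr_hom D.homologyIso.hom_inv_id α
  rw [ConcreteCategory.comp_apply, ConcreteCategory.comp_apply] at h1
  rw [← h1]
  refine (congrArg _ ?_).trans h2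
  exact hy

theorem homologyπ_eq_zero_iff (S : ShortComplex (TopModuleCat.{u} R)) (x : S.cycles) :
    S.homologyπ x = 0 ↔ ∃ y : S.X₁, S.f y = S.iCycles x := by
  let D := leftHomologyData S
  have h1 := ConcreteCategory.congr_hom D.homologyπ_comp_homologyIso_hom x
  have h2 := ConcreteCategory.congr_hom D.cyclesIso_hom_comp_i x
  have h3 : ∀ y : S.X₁, D.i (D.f' y) = S.f y := fun y => ConcreteCategory.congr_hom D.f'_i y
  have hi : Function.Injective D.i := Subtype.val_injective
  rw [ConcreteCategory.comp_apply, ConcreteCategory.comp_apply] at h1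
  rw [ConcreteCategory.comp_apply] at h2
  have h4 : S.homologyπ x = 0 ↔ D.π (D.cyclesIso.hom x) = 0 := by
    rw [← h1]
    refine ⟨fun h => by rw [h, map_zero], fun h => ?_⟩
    have h5 := ConcreteCategory.congr_hom D.homologyIso.hom_inv_id (S.homologyπ x)
    rw [ConcreteCategory.comp_apply, h, map_zero] at h5
    exact h5.symm
  have h5 : D.π (D.cyclesIso.hom x) = 0 ↔ D.cyclesIso.hom x ∈ D.f'.hom.range :=
    Submodule.Quotient.mk_eq_zero _
  rw [h4, h5]
  refine ⟨fun ⟨y, hy⟩ => ⟨y, ?_⟩, fun ⟨y, hy⟩ => ⟨y, hi ?_⟩⟩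
  · rw [← h3, ← h2]
    exact congrArg D.i hy
  · rw [h2, ← hy]
    exact h3 y

/-- A cohomology class has a representing cocycle, and the image of the class under a map of
complexes vanishes exactly when the image of the cocycle is a coboundary. -/
theorem exists_cocycle {C : CochainComplex (TopModuleCat.{u} R) ℕ} {n : ℕ}
    (α : C.homology (n + 1)) : ∃ z : C.X (n + 1), C.d (n + 1) (n + 2) z = 0 ∧
      ∀ (D : CochainComplex (TopModuleCat.{u} R) ℕ) (φ : C ⟶ D),
        HomologicalComplex.homologyMap φ (n + 1) α = 0 ↔
          ∃ y : D.X n, D.d n (n + 1) y = φ.f (n + 1) z := by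
  obtain ⟨x, rfl⟩ := exists_homologyπ_eq (C.sc (n + 1)) α
  let x : C.cycles (n + 1) := x
  refine ⟨C.iCycles (n + 1) x, ?_, fun D φ => ?_⟩
  · exact ConcreteCategory.congr_hom (C.iCycles_d (n + 1) (n + 2)) x
  · have h1 := ConcreteCategory.congr_hom (HomologicalComplex.homologyπ_naturality φ (n + 1)) x
    have h2 := ConcreteCategory.congr_hom (HomologicalComplex.cyclesMap_i φ (n + 1)) x
    rw [ConcreteCategory.comp_apply, ConcreteCategory.comp_apply] at h1 h2
    have key : ∀ i, (ComplexShape.up ℕ).prev (n + 1) = i → ∀ w : D.cycles (n + 1),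
        D.homologyπ (n + 1) w = 0 ↔ ∃ y : D.X i, D.d i (n + 1) y = D.iCycles (n + 1) w := by
      rintro _ rfl w
      exact homologyπ_eq_zero_iff (D.sc (n + 1)) w
    rw [← h2]
    refine Iff.trans ?_ (key n (CochainComplex.prev_nat_succ n) _)
    rw [← h1]
    rfl

end Homology

end GaloisSplitting

namespace GaloisSplitting

open TopRep NestedFun

/-! ### Restriction of classes in terms of finite quotients -/

section Restriction

variable {Γ : Type u} [Group Γ] [TopologicalSpace Γ] [IsTopologicalGroup Γ] (X : TopRep.{u} ℤ Γ)

/-- A class of positive degree in nested form: an invariant cocycle whose restrictions decide the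
vanishing of the restrictions of the class. -/
theorem exists_nested_cocycle {n : ℕ} (α : continuousCohomology (n + 1) X) :
    ∃ z : (resolutionX X (n + 2)).V,
      (∀ γ, act (coeffHom X) γ (n + 2) (toNested X (n + 2) z) = toNested X (n + 2) z) ∧
      diff Γ X.V (n + 2) (toNested X (n + 2) z) = 0 ∧
      ∀ (Γ' : Type u) [Group Γ'] [TopologicalSpace Γ'] [IsTopologicalGroup Γ'] (φ : Γ' →ₜ* Γ),
        ContinuousCohomology.map φ (𝟙 (TopRep.res (φ : Γ' →* Γ) X)) (n + 1) α = 0 ↔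
          ∃ y : (resolutionX (TopRep.res (φ : Γ' →* Γ) X) (n + 1)).V,
            (∀ γ, act ((coeffHom X).comp (φ : Γ' →* Γ)) γ (n + 1) (toNested _ (n + 1) y) =
              toNested _ (n + 1) y) ∧
            diff Γ' X.V (n + 1) (toNested _ (n + 1) y) = pull X.V φ (n + 2) (toNested X (n + 2) z) := by
  obtain ⟨z, hz, h⟩ := exists_cocycle (C := homogeneousCochains X) α
  refine ⟨z.1, fun γ => ?_, ?_, fun Γ' _ _ _ φ => ?_⟩
  · rw [← toNested_ρ]
    exact congrArg _ (z.2 γ)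
  · rw [← toNested_d]
    have h1 := homogeneousCochains.d_apply X (n + 1) z
    have h2 : (d X (n + 2)).hom z.1 = 0 := h1.symm.trans (congrArg Subtype.val hz)
    exact (congrArg _ h2).trans (map_zero _)
  · refine (h (homogeneousCochains (TopRep.res (φ : Γ' →* Γ) X))
      (ContinuousCohomology.cochainsMap φ (𝟙 _))).trans ?_
    have key : ∀ y : (homogeneousCochains (TopRep.res (φ : Γ' →* Γ) X)).X n,
        (homogeneousCochains (TopRep.res (φ : Γ' →* Γ) X)).d n (n + 1) y =
          (ContinuousCohomology.cochainsMap φ (𝟙 (TopRep.res (φ : Γ' →* Γ) X))).f (n + 1) z ↔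
        diff Γ' X.V (n + 1) (toNested _ (n + 1) y.1) =
          pull X.V φ (n + 2) (toNested X (n + 2) z.1) := by
      intro y
      have h1 := homogeneousCochains.d_apply (TopRep.res (φ : Γ' →* Γ) X) n y
      have h2 := toNested_d (TopRep.res (φ : Γ' →* Γ) X) y.1
      have h3 := toNested_resolutionMap X φ z.1
      refine Iff.trans ?_ (Eq.congr h2 h3)
      rw [(toNested_injective _ _).eq_iff]
      refine ⟨fun h => h1.symm.trans (congrArg Subtype.val h), fun h => Subtype.ext (h1.trans h)⟩
    refine ⟨fun ⟨y, hy⟩ => ⟨y.1, fun γ => ?_, (key y).1 hy⟩, fun ⟨y, hy, hd⟩ => ?_⟩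
    · have := toNested_ρ (TopRep.res (φ : Γ' →* Γ) X) γ y.1
      rw [y.2 γ] at this
      exact this.symm
    · refine ⟨⟨y, fun γ => toNested_injective _ _ ?_⟩, (key _).2 hd⟩
      exact (toNested_ρ (TopRep.res (φ : Γ' →* Γ) X) γ y).trans (hy γ)

variable {X} {G : Type u} [Group G] {χ : G →* AddMonoid.End X.V} {n : ℕ}
  {c : NestedFun G X.V (n + 1)} {p : Γ →* G}

/-- A trivialisation of a cocycle on a compact group comes from a trivialisation on every sufficiently
fine quotient. -/
theorem exists_nhds_forall_diesOn [CompactSpace Γ] [DiscreteTopology X.V] (y : (resolutionX X n).V)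
    (hy : ∀ γ, act (χ.comp p) γ n (toNested X n y) = toNested X n y)
    (hd : diff Γ X.V n (toNested X n y) = pull X.V p (n + 1) c) :
    ∃ U ∈ nhds (1 : Γ), ∀ (H : Type u) [Group H] (q : Γ →* H), Function.Surjective q →
      (q.ker : Set Γ) ⊆ U → ∀ p' : H →* G, p'.comp q = p → DiesOn χ c p' := by
  obtain ⟨U, hU, h⟩ := exists_nhds_forall_exists_pull_eq X y
  refine ⟨U, hU, fun H _ q hq hqU p' hp => ?_⟩
  subst hp
  obtain ⟨φ, hφ⟩ := h H q hqU
  rw [hφ] at hy hd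
  refine ⟨φ, fun x => pull_injective hq ?_, pull_injective hq ?_⟩
  · obtain ⟨γ, rfl⟩ := hq x
    rw [← act_pull, MonoidHom.comp_assoc, hy]
  · rw [pull_diff, hd, pull_pull]
    rfl

/-- A cocycle that dies on a discrete group is trivialised over every group that maps to it. -/
theorem exists_diff_eq_of_diesOn {H : Type u} [Group H] {p' : H →* G} (h : DiesOn χ c p')
    {r : Γ →* H} (hr : IsLocallyConstant r) (hp : p'.comp r = p) :
    ∃ y : (resolutionX X n).V,
      (∀ γ, act (χ.comp p) γ n (toNested X n y) = toNested X n y) ∧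
      diff Γ X.V n (toNested X n y) = pull X.V p (n + 1) c := by
  subst hp
  obtain ⟨φ, hφ, hd⟩ := h
  refine ⟨ofNested X hr n φ, fun γ => ?_, ?_⟩
  · rw [toNested_ofNested, ← MonoidHom.comp_assoc, act_pull, hφ]
  · rw [toNested_ofNested, ← pull_diff, hd, pull_pull]
    rfl

theorem isLocallyConstant_of_isOpen_ker {H : Type u} [Group H] {r : Γ →* H}
    (hr : IsOpen (r.ker : Set Γ)) : IsLocallyConstant r := by
  refine (IsLocallyConstant.iff_eventually_eq _).2 fun γ => ?_
  have : ∀ᶠ x in nhds γ, γ⁻¹ * x ∈ (r.ker : Set Γ) :=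
    (continuous_const.mul continuous_id).continuousAt.eventually_mem (hr.mem_nhds (by simp))
  filter_upwards [this] with x hx
  rw [SetLike.mem_coe, MonoidHom.mem_ker, map_mul, map_inv, inv_mul_eq_one] at hx
  exact hx.symm

end Restriction

end GaloisSplitting

namespace GaloisSplitting

open TopRep NestedFun

/-! ### The splitting ind-variety -/

section Criterion

variable {k ks : Type u} [Field k] [Field ks] [Algebra k ks] [IsSepClosure k ks]

theorem isOpen_ker_restrictNormalHom {l ls : Type u} [Field l] [Field ls] [Algebra l ls]
    [IsGalois l ls] (L : FiniteGaloisIntermediateField l ls) :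
    IsOpen ((AlgEquiv.restrictNormalHom (F := l) (K₁ := ls) L).ker : Set Gal(ls/l)) := by
  rw [IntermediateField.restrictNormalHom_ker]
  exact L.toIntermediateField.fixingSubgroup_isOpen

theorem exists_comp_eq_of_ker_le {G H N : Type u} [Group G] [Group H] [Monoid N] {q : G →* H}
    (hq : Function.Surjective q) {f : G →* N} (h : ∀ x, q x = 1 → f x = 1) :
    ∃ g : H →* N, g.comp q = f := by
  have hf : ∀ x y, q x = q y → f x = f y := fun x y hxy => by
    have h1 : f (x * y⁻¹) = 1 := h _ (by rw [map_mul, map_inv, hxy, mul_inv_cancel])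
    rw [← inv_mul_cancel_right x y, map_mul, h1, one_mul]
  choose s hs using hq
  exact ⟨{ toFun := fun x => f (s x)
           map_one' := (hf _ 1 (by rw [hs, map_one])).trans (map_one f)
           map_mul' := fun x y => (hf _ (s x * s y) (by rw [hs, map_mul, hs, hs])).trans
            (map_mul f _ _) }, MonoidHom.ext fun x => hf _ _ (hs _)⟩

/-- A continuous cochain and the action on the coefficients come from a finite Galois extension. -/
theorem exists_finite_level {A : Type u} [AddCommGroup A] [Finite A] [TopologicalSpace A]
    [DiscreteTopology A] [DistribMulAction Gal(ks/k) A] [ContinuousSMul Gal(ks/k) A] {n : ℕ}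
    (z : (resolutionX (discreteModule Gal(ks/k) A) n).V) :
    ∃ (K : FiniteGaloisIntermediateField k ks) (χ : Gal(K/k) →* AddMonoid.End A)
      (c : NestedFun Gal(K/k) A n),
      χ.comp (AlgEquiv.restrictNormalHom K) = coeffHom (discreteModule Gal(ks/k) A) ∧
      toNested (discreteModule Gal(ks/k) A) n z = pull A (AlgEquiv.restrictNormalHom K) n c := by
  have : IsGalois k ks := inferInstance
  have : DiscreteTopology (discreteModule Gal(ks/k) A).V := inferInstanceAs (DiscreteTopology A)
  obtain ⟨U, hU, h⟩ := exists_nhds_forall_exists_pull_eq (discreteModule Gal(ks/k) A) z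
  have hV : {γ : Gal(ks/k) | ∀ a : A, γ • a = a} ∈ nhds 1 := by
    have : {γ : Gal(ks/k) | ∀ a : A, γ • a = a} = ⋂ a : A, {γ | γ • a = a} := by
      ext γ
      simp
    rw [this]
    refine Filter.iInter_mem.2 fun a => ?_
    have hc : Continuous fun γ : Gal(ks/k) => γ • a := by fun_prop
    exact ((isOpen_discrete {a}).preimage hc).mem_nhds (by simp)
  obtain ⟨K, hK⟩ := (InfiniteGalois.krullTopology_mem_nhds_one_iff_of_isGalois _).1 (Filter.inter_mem hU hV)
  have hq : Function.Surjective (AlgEquiv.restrictNormalHom (F := k) (K₁ := ks) K) :=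
    AlgEquiv.restrictNormalHom_surjective ks
  rw [← IntermediateField.restrictNormalHom_ker] at hK
  obtain ⟨c, hc⟩ := h Gal(K/k) (AlgEquiv.restrictNormalHom K) fun x hx => (hK hx).1
  obtain ⟨χ, hχ⟩ := exists_comp_eq_of_ker_le hq (f := coeffHom (discreteModule Gal(ks/k) A))
    fun γ hγ => by
      ext a
      exact (hK hγ).2 a
  exact ⟨K, χ, c, hχ, hc⟩

/-- The restriction of the class of `c` to `l` vanishes exactly when the Galois representation of `l`
on `K` lifts to a finite group on which `c` dies. -/
theorem res_eq_zero_iff {A : Type u} [AddCommGroup A] [TopologicalSpace A]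
    [DiscreteTopology A] [DistribMulAction Gal(ks/k) A] {n : ℕ}
    (K : FiniteGaloisIntermediateField k ks) {χ : Gal(K/k) →* AddMonoid.End A}
    {c : NestedFun Gal(K/k) A (n + 1)}
    (hχ : χ.comp (AlgEquiv.restrictNormalHom K) = coeffHom (discreteModule Gal(ks/k) A))
    {l ls : Type u} [Field l] [Algebra k l] [Field ls] [Algebra l ls]
    [IsSepClosure l ls] [Algebra k ls] [IsScalarTower k l ls] [Algebra ks ls]
    [IsScalarTower k ks ls] :
    (∃ y : (resolutionX (TopRep.res (restrict k ks l ls : Gal(ls/l) →* Gal(ks/k))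
        (discreteModule Gal(ks/k) A)) n).V,
      (∀ γ, act ((coeffHom (discreteModule Gal(ks/k) A)).comp
          (restrict k ks l ls : Gal(ls/l) →* Gal(ks/k))) γ n (toNested _ n y) = toNested _ n y) ∧
      diff Gal(ls/l) A n (toNested _ n y) = pull A (restrict k ks l ls) (n + 1)
        (pull A (AlgEquiv.restrictNormalHom K) (n + 1) c)) ↔
    ∃ (H : Type u) (_ : Group H) (_ : Finite H) (p : H →* Gal(K/k)) (r : Gal(ls/l) →* H),
      DiesOn χ c p ∧ IsLift p r := by
  let q : Gal(ks/k) →* Gal(K/k) := AlgEquiv.restrictNormalHom K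
  let φ : Gal(ls/l) →* Gal(ks/k) := restrict k ks l ls
  let X := TopRep.res φ (discreteModule Gal(ks/k) A)
  have : IsGalois l ls := inferInstance
  have : DiscreteTopology X.V := inferInstanceAs (DiscreteTopology A)
  have hφq : ∀ γ x, algebraMap K ls (q (φ γ) x) = γ (algebraMap K ls x) := fun γ x => by
    change algebraMap ks ls (q (φ γ) x : K) = γ (algebraMap ks ls x)
    rw [AlgEquiv.restrictNormalHom_apply]
    exact algebraMap_restrictHom k ks l ls γ x
  rw [← hχ, pull_pull]
  constructor
  · rintro ⟨y, hy, hd⟩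
    obtain ⟨U, hU, h⟩ := exists_nhds_forall_diesOn (X := X) (p := q.comp φ) y hy hd
    have hW : IsOpen ((q.comp φ).ker : Set Gal(ls/l)) :=
      (isOpen_ker_restrictNormalHom K).preimage (restrict k ks l ls).continuous_toFun
    obtain ⟨L, hL⟩ := (InfiniteGalois.krullTopology_mem_nhds_one_iff_of_isGalois _).1
      (Filter.inter_mem hU (hW.mem_nhds (one_mem _)))
    rw [← IntermediateField.restrictNormalHom_ker] at hL
    have hs : Function.Surjective (AlgEquiv.restrictNormalHom (F := l) (K₁ := ls) L) :=
      AlgEquiv.restrictNormalHom_surjective ls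
    obtain ⟨p, hp⟩ := exists_comp_eq_of_ker_le hs (f := q.comp φ) fun γ hγ => (hL hγ).2
    refine ⟨Gal(L/l), inferInstance, inferInstance, p, AlgEquiv.restrictNormalHom L,
      h _ _ hs (fun γ hγ => (hL hγ).1) p hp, isOpen_ker_restrictNormalHom L, fun γ x => ?_⟩
    rw [← hφq]
    exact congr(algebraMap K ls ($hp γ x))
  · rintro ⟨H, _, _, p, r, hdies, hr⟩
    refine exists_diff_eq_of_diesOn (X := X) (p := q.comp φ) hdies (isLocallyConstant_of_isOpen_ker hr.isOpen_ker)
      (MonoidHom.ext fun γ => AlgEquiv.ext fun x => (algebraMap K ls).injective ?_)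
    exact (hr.algebraMap_apply γ x).trans (hφq γ x).symm

/-- Every class of degree at least two has a splitting family that is a smooth, geometrically
integral ind-variety. -/
theorem exists_isSplittingFamily (A : Type u) [AddCommGroup A] [Finite A] [TopologicalSpace A]
    [DiscreteTopology A] [DistribMulAction Gal(ks/k) A] [ContinuousSMul Gal(ks/k) A] (m : ℕ)
    (α : galoisCohomology k ks (m + 2) (discreteModule Gal(ks/k) A)) :
    ∃ X : SmoothGeomIntegralIndVariety k, IsSplittingFamily α X.X := by
  obtain ⟨z, hz, hd, hres⟩ := exists_nested_cocycle _ α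
  obtain ⟨K, χ, c, hχ, hc⟩ := exists_finite_level z
  have hq : Function.Surjective (AlgEquiv.restrictNormalHom (F := k) (K₁ := ks) K) :=
    AlgEquiv.restrictNormalHom_surjective ks
  have hcinv : ∀ g, act χ g (m + 3) c = c := by
    intro g
    obtain ⟨γ, rfl⟩ := hq g
    refine pull_injective hq ?_
    rw [← act_pull, hχ, ← hc]
    exact hz γ
  have hcd : diff Gal(K/k) A (m + 3) c = 0 := by
    refine pull_injective hq ?_
    rw [pull_diff, ← hc, map_zero]
    exact hd
  obtain ⟨E, hE, hfac⟩ := exists_splittingGroup_tower χ hcinv hcd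
  classical
  let _ (i : ℕ) : Fintype (E i).carrier := Fintype.ofFinite _
  have (i : ℕ) : Algebra.Smooth k (QuotientRing (E i).proj) := QuotientRing.smooth _
  obtain ⟨X, hX⟩ := exists_indVariety (fun i => QuotientRing (E i).proj)
    (fun i Ω _ _ => QuotientRing.isDomain_tensorProduct (E i).proj_surjective Ω)
    fun i => (hE i).elim fun j hj => QuotientRing.nonempty_algHom j hj.1 hj.2
  refine ⟨X, fun l ls _ _ _ _ _ _ _ _ _ _ => ?_⟩
  have hcrit := res_eq_zero_iff K (c := c) hχ (l := l) (ls := ls)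
  rw [← hc] at hcrit
  refine ((hres Gal(ls/l) (restrict k ks l ls)).trans hcrit).trans ?_
  simp only [hX]
  constructor
  · rintro ⟨H, _, _, p, r, hdies, hr⟩
    obtain ⟨i, j, hj⟩ := hfac H p hdies
    refine ⟨i, (QuotientRing.nonempty_algHom_iff (ls := ls) (E i).proj_surjective).2
      ⟨j.comp r, ?_, fun γ x => ?_⟩⟩
    · exact Subgroup.isOpen_mono (fun γ hγ => by
        rw [MonoidHom.mem_ker] at hγ ⊢
        rw [MonoidHom.comp_apply, hγ, map_one]) hr.isOpen_ker
    · rw [← hr.algebraMap_apply, ← hj]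
      rfl
  · rintro ⟨i, hi⟩
    obtain ⟨r, hr⟩ := (QuotientRing.nonempty_algHom_iff (ls := ls) (E i).proj_surjective).1 hi
    exact ⟨(E i).carrier, inferInstance, inferInstance, (E i).proj, r, (E i).dies, hr⟩

end Criterion

end GaloisSplitting

theorem mainTheorem1 (k ks : Type u) [Field k] [Field ks] [Algebra k ks] [IsSepClosure k ks]
    (A : Type u) [AddCommGroup A] [Finite A] [TopologicalSpace A] [DiscreteTopology A]
    [DistribMulAction Gal(ks/k) A] [ContinuousSMul Gal(ks/k) A]
    (hA : (Nat.card A : k) ≠ 0) (n : ℕ) (hn : 3 ≤ n)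
    (α : GaloisSplitting.galoisCohomology k ks n
      (GaloisSplitting.discreteModule Gal(ks/k) A)) :
    ∃ X : GaloisSplitting.SmoothGeomIntegralIndVariety k,
      GaloisSplitting.IsSplittingFamily α X.X := by
  obtain ⟨m, rfl⟩ : ∃ m, n = m + 2 := ⟨n - 2, by omega⟩
  exact GaloisSplitting.exists_isSplittingFamily A m α
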